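/- **Setting.** Let $(\mathcal S,\mathcal A,P,r,\gamma)$ be a discounted Markov decision process with measurable state space $\mathcal S$, finite non-empty action space $\mathcal A$, reward $r:\mathcal S\times\mathcal A\to[0,r_{max}]$ and $\gamma\in(0,1)$; state-action pairs $(s,a)$ are represented (measurably) as vectors of $\mathbb R^d$ with $\|(s,a)\|_2\le 1$. Let $\mu$ be an initial state distribution, $\lambda>0$ and $R>0$. For a (stationary, randomized) policy $\pi$ let $V_\lambda^\pi(s)=\mathbb E[\sum_{t\ge0}\gamma^t r(s_t,a_t)\mid s_0=s]+\lambda\,\mathbb E[\sum_{t\ge0}\gamma^t\mathcal H(\pi(\cdot|s_t))\mid s_0=s]$, with $\mathcal H$ the Shannon entropy, $V_\lambda^\pi(\mu)=\mathbb E_{s\sim\mu}[V_\lambda^\pi(s)]$, $Q_\lambda^\pi(s,a)=r(s,a)+\gamma\,\mathbb E_{s'\sim P(\cdot|s,a)}[V_\lambda^\pi(s')]$, and $d_\mu^\pi=(1-\gamma)\sum_{k\ge0}\gamma^k\,\mathbb P(s_k\in\cdot\mid s_0\sim\mu)$. Let $\pi^*$ be a policy maximizing $V_\lambda^{\pi}(\mu)$,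 and let $\Psi(\pi)=\mathbb E_{s\sim d_\mu^{\pi^*}}[D_{KL}(\pi^*(\cdot|s)\,\|\,\pi(\cdot|s))]$. The actor network has even width $m\ge2$: $f(s,a;(c,\theta))=\frac1{\sqrt m}\sum_{i=1}^m c_i\max\{0,\langle\theta_i,(s,a)\rangle\}$, with gradient $\nabla_\theta f=\big[\frac1{\sqrt m}c_i\mathbb 1\{\langle\theta_i,(s,a)\rangle\ge0\}(s,a)\big]_{i\in[m]}$ and policy $\pi_\theta(a|s)\propto\exp f(s,a;(c,\theta))$. Symmetric initialization: for $i\le m/2$, $c_i=-c_{i+m/2}$ is a Rademacher sign and $\theta_i(0)=\theta_{i+m/2}(0)\sim\mathcal N(0,I_d)$, all independent; $c$ stays fixed. The entropy-regularized neural natural actor-critic algorithm is, for $t=0,1,\dots$, with $\pi_t=\pi_{\theta(t)}$: * Critic: from a (fresh) symmetric initialization $(b,W(0))$ of a network $\hat q(\cdot;(b,W))$ of the same form and even width $m'\ge2$, run, for TD samples $(s_j,a_j,s_j',a_j')$, $W_i(j+1)=\mathcal P_{\{\|y-W_i(0)\|_2\le R/\sqrt{m'}\}}\big(W_i(j)+\alpha_C\,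 e_j\nabla_{W_i}\hat q_j(s_j,a_j)\big)$ with $\hat q_j=\hat q(\cdot;(b,W(j)))$ and $e_j=r(s_j,a_j)-\lambda\log\pi_t(a_j|s_j)+\gamma\hat q_j(s_j',a_j')-\hat q_j(s_j,a_j)$. Put $\overline Q(s,a)=\hat q\big(s,a;(b,\frac1{T'}\sum_{j<T'}W(j))\big)-\lambda\log\pi_t(a|s)$ and $\hat\Xi(s,a)=\overline Q(s,a)-\sum_{a'}\pi_t(a'|s)\overline Q(s,a')$. * Actor: with $g_n=\nabla_\theta\log\pi_t(a_n|s_n)=\nabla_\theta f_t(s_n,a_n)-\sum_{a'}\pi_t(a'|s_n)\nabla_\theta f_t(s_n,a')$, where $f_t=f(\cdot;(c,\theta(t)))$, for SGD samples $(s_n,a_n)$, set $u_0^{(t)}=0$, $u_{n+1}^{(t)}=\mathcal P_{\mathcal B}\big(u_n^{(t)}-\alpha_A(\langle g_n,u_n^{(t)}\rangle-\hat\Xi(s_n,a_n))g_n\big)$ with $\mathcal B=\{y\in\mathbb R^{m\times d}:\max_i\|y_i\|_2\le R/\sqrt m\}$, and $u_t=\frac1N\sum_{n=1}^N u_n^{(t)}$;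 then $\theta(t+1)=\theta(t)+\eta_tu_t-\eta_t\lambda(\theta(t)-\theta(0))$. Here $\mathcal P_C$ is the Euclidean projection onto $C$; $\alpha_A,\alpha_C>0$, $N,T'\ge1$, and the step-sizes satisfy $0<\eta_t\le1/\lambda$ for all $t$ (as do $\eta_t=\frac1{\lambda(t+1)}$ and $\eta_t=\eta\in(0,1/\lambda)$). For $\delta\in(0,1)$ and $R_0>0$ let $\rho_0(R_0,m,\delta)=\frac{16R_0}{\sqrt m}\big(R_0+\sqrt{\log(1/\delta)}+\sqrt{d\log m}\big)$ and, with $R_0=R/\lambda$, let $A_0$ be the event (on the actor initialization) $$A_0=\Big\{\sup_{x\in\mathbb R^d:\|x\|_2=1}\frac{R_0}{m}\sum_{i=1}^m\mathbb 1\Big\{|\langle\theta_i(0),x\rangle|\le\frac{R_0}{\sqrt m}\Big\}\le\rho_0(R_0,m,\delta)\Big\}.$$ **Lemma (Lyapunov drift).** $\mathbb P(A_0)\ge1-\delta$ over the random initialization of the actor. Moreover, on $A_0$, for every realization of the critic initializations and of the samples and every $t\ge0$, with $\Delta_t=V_\lambda^{\pi^*}(\mu)-V_\lambda^{\pi_t}(\mu)$,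 $f_0=f(\cdot;(c,\theta(0)))$ and $\rho_0=\rho_0(R/\lambda,m,\delta)$, $$\begin{aligned}\Psi(\pi_{t+1})-\Psi(\pi_t)\le{}&-\eta_t\lambda\Psi(\pi_t)-\eta_t(1-\gamma)\Delta_t+2\eta_t^2R^2\\&+\eta_t\,\mathbb E_{s\sim d_\mu^{\pi^*},a\sim\pi_t(\cdot|s)}\big[\nabla^\top f_0(s,a)u_t-Q_\lambda^{\pi_t}(s,a)\big]\\&-\eta_t\,\mathbb E_{s\sim d_\mu^{\pi^*},a\sim\pi^*(\cdot|s)}\big[\nabla^\top f_0(s,a)u_t-Q_\lambda^{\pi_t}(s,a)\big]\\&+(\eta_t\lambda+6)\rho_0+2\eta_tR\sqrt{\rho_0}.\end{aligned}$$ -/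

import Mathlib

open MeasureTheory ProbabilityTheory
open scoped ENNReal

noncomputable section

namespace NeuralNAC

/-! ### Markov decision processes and policies -/

/-- The Euclidean space `ℝ^d` in which state-action pairs are represented. -/
abbrev E (d : ℕ) := EuclideanSpace ℝ (Fin d)

/-- Discounted Markov decision process with measurable state space `S`, action space `A`,
transition kernel `P`, reward `r : S × A → [0, rmax]`, discount factor `γ ∈ (0,1)`. State-action
pairs are represented by vectors `feat s a` in the unit ball of `ℝ^d`. -/
structure MDP (S A : Type*) [MeasurableSpace S] [MeasurableSpace A] (d : ℕ) where
  P : Kernel (S × A) S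
  markov : IsMarkovKernel P
  r : S → A → ℝ
  rmax : ℝ
  r_meas : ∀ a, Measurable fun s => r s a
  r_nonneg : ∀ s a, 0 ≤ r s a
  r_le : ∀ s a, r s a ≤ rmax
  γ : ℝ
  γ_pos : 0 < γ
  γ_lt_one : γ < 1
  feat : S → A → E d
  feat_meas : ∀ a, Measurable fun s => feat s a
  feat_norm : ∀ s a, ‖feat s a‖ ≤ 1

attribute [instance] MDP.markov

/-- Stationary randomized policy `π(a|s)` over a finite action space. -/
structure Policy (S A : Type*) [MeasurableSpace S] [Fintype A] where
  prob : S → A → ℝ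
  meas : ∀ a, Measurable fun s => prob s a
  nonneg : ∀ s a, 0 ≤ prob s a
  sum_one : ∀ s, ∑ a, prob s a = 1

section Policies

variable {S A : Type*} [MeasurableSpace S] [Fintype A] [MeasurableSpace A]

/-- The Markov kernel `s ↦ π(·|s)`. -/
def Policy.kernel (π : Policy S A) : Kernel S A where
  toFun s := ∑ a, ENNReal.ofReal (π.prob s a) • Measure.dirac a
  measurable' := by
    refine Measure.measurable_of_measurable_coe _ fun t ht => ?_
    simp only [Measure.coe_finsetSum, Finset.sum_apply, Measure.smul_apply, smul_eq_mul]
    exact Finset.measurable_sum _ fun a _ => ((π.meas a).ennreal_ofReal).mul_const _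

instance (π : Policy S A) : IsMarkovKernel π.kernel := by
  refine ⟨fun s => ⟨?_⟩⟩
  change (∑ a, ENNReal.ofReal (π.prob s a) • Measure.dirac a : Measure A) Set.univ = 1
  simp only [Measure.coe_finsetSum, Finset.sum_apply, Measure.smul_apply, smul_eq_mul,
    measure_univ, mul_one]
  rw [← ENNReal.ofReal_sum_of_nonneg fun a _ => π.nonneg s a, π.sum_one, ENNReal.ofReal_one]

/-- Entropy `𝓗(π(·|s)) = -∑ₐ π(a|s) log π(a|s)`. -/
def Policy.entropy (π : Policy S A) (s : S) : ℝ := -∑ a, π.prob s a * Real.log (π.prob s a)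

/-- Kullback-Leibler divergence `D_KL(π(·|s) ‖ π'(·|s))`. -/
def Policy.kl (π π' : Policy S A) (s : S) : ℝ :=
  ∑ a, π.prob s a * Real.log (π.prob s a / π'.prob s a)

/-- `E_{s ∼ ν, a ∼ π(·|s)}[g(s,a)]`. -/
def expect (ν : Measure S) (π : Policy S A) (g : S → A → ℝ) : ℝ :=
  ∫ s, ∑ a, π.prob s a * g s a ∂ν

namespace MDP

variable {d : ℕ} (M : MDP S A d)

/-- One step of the state-action chain under `π`: `s' ∼ P(·|s,a)`, `a' ∼ π(·|s')`. -/
def step (π : Policy S A) : Kernel (S × A) (S × A) :=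
  M.P.compProd (Kernel.prodMkLeft (S × A) π.kernel)

instance (π : Policy S A) : IsMarkovKernel (M.step π) := by
  unfold step; infer_instance

/-- Law of the trajectory `(s₀,a₀),(s₁,a₁),…` under `π` with `s₀ ∼ ν`. -/
def pathLaw (π : Policy S A) (ν : Measure S) : Measure (ℕ → S × A) :=
  Kernel.trajMeasure (X := fun _ => S × A) (ν.compProd π.kernel)
    fun n => (M.step π).comap (fun h => h ⟨n, Finset.mem_Iic.2 le_rfl⟩) (by fun_prop)

/-- Value function `V^π(s)`. -/
def V (π : Policy S A) (s : S) : ℝ :=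
  ∫ ω, ∑' t : ℕ, M.γ ^ t * M.r (ω t).1 (ω t).2 ∂(M.pathLaw π (Measure.dirac s))

/-- Discounted entropy `H^π(s)`. -/
def H (π : Policy S A) (s : S) : ℝ :=
  ∫ ω, ∑' t : ℕ, M.γ ^ t * π.entropy (ω t).1 ∂(M.pathLaw π (Measure.dirac s))

/-- Entropy-regularized value function `V_λ^π(s)`. -/
def Vreg (lam : ℝ) (π : Policy S A) (s : S) : ℝ := M.V π s + lam * M.H π s

/-- `V_λ^π(μ) = E_{s₀ ∼ μ}[V_λ^π(s₀)]`. -/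
def Vmean (lam : ℝ) (μ : Measure S) (π : Policy S A) : ℝ := ∫ s, M.Vreg lam π s ∂μ

/-- Soft Q-function `Q_λ^π(s,a) = r(s,a) + γ E_{s' ∼ P(·|s,a)}[V_λ^π(s')]`. -/
def Q (lam : ℝ) (π : Policy S A) (s : S) (a : A) : ℝ :=
  M.r s a + M.γ * ∫ s', M.Vreg lam π s' ∂(M.P (s, a))

/-- Discounted state visitation distribution
`d_μ^π = (1-γ) ∑ₖ γ^k ℙ(s_k ∈ · | s₀ ∼ μ)`. -/
def visit (μ : Measure S) (π : Policy S A) : Measure S :=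
  Measure.sum fun n : ℕ =>
    ENNReal.ofReal ((1 - M.γ) * M.γ ^ n) • (M.pathLaw π μ).map fun ω => (ω n).1

/-- `π` maximizes the entropy-regularized objective `V_λ^π(μ)` among all policies. -/
def IsOptimal (lam : ℝ) (μ : Measure S) (π : Policy S A) : Prop :=
  ∀ π' : Policy S A, M.Vmean lam μ π' ≤ M.Vmean lam μ π

/-- Potential function `Ψ(π) = E_{s ∼ d_μ^{π*}}[D_KL(π*(·|s) ‖ π(·|s))]`. -/
def potential (μ : Measure S) (πopt π : Policy S A) : ℝ :=
  ∫ s, πopt.kl π s ∂(M.visit μ πopt)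

end MDP

end Policies

/-! ### Two-layer ReLU networks, softmax policies, random initialization -/

/-- Hidden-layer weights in `ℝ^{m × d}`, with the Euclidean (Frobenius) inner product. -/
abbrev Weights (m d : ℕ) := PiLp 2 fun _ : Fin m => E d

/-- `f(x; (c,θ)) = m^{-1/2} ∑ᵢ cᵢ max(0, ⟨θᵢ, x⟩)`. -/
def net {m d : ℕ} (c : Fin m → ℝ) (θ : Weights m d) (x : E d) : ℝ :=
  1 / Real.sqrt m * ∑ i, c i * max 0 (inner ℝ (θ i) x)

/-- Gradient of the network output in `θ`, with rows `m^{-1/2} cᵢ 𝟙{⟨θᵢ, x⟩ ≥ 0} x`. -/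
def netGrad {m d : ℕ} (c : Fin m → ℝ) (θ : Weights m d) (x : E d) : Weights m d :=
  WithLp.toLp 2 fun i => (1 / Real.sqrt m * c i * if 0 ≤ inner ℝ (θ i) x then 1 else 0) • x

/-- Random initialization of a network of width `k + k`: signs and weight vectors of the
first `k` neurons. -/
abbrev Init (k d : ℕ) := (Fin k → ℤˣ) × (Fin k → E d)

/-- Output weights: `c_i = - c_{i+k}`. -/
def Init.c {k d : ℕ} (w : Init k d) : Fin (k + k) → ℝ :=
  Fin.append (fun i => ((w.1 i : ℤ) : ℝ)) fun i => -((w.1 i : ℤ) : ℝ)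

/-- Hidden weights: `θ_i(0) = θ_{i+k}(0)`. -/
def Init.θ {k d : ℕ} (w : Init k d) : Weights (k + k) d :=
  WithLp.toLp 2 (Fin.append w.2 w.2)

/-- Law of the symmetric initialization: independent Rademacher signs and independent standard
Gaussian vectors. -/
def symInit (k d : ℕ) : Measure (Init k d) :=
  (Measure.pi fun _ : Fin k => uniformOn (Set.univ : Set ℤˣ)).prod
    (Measure.pi fun _ : Fin k => stdGaussian (E d))

/-- `ρ₀(R₀,m,δ) = 16 R₀ m^{-1/2} (R₀ + √log(1/δ) + √(d log m))`. -/
def rho (d : ℕ) (R₀ : ℝ) (m : ℕ) (δ : ℝ) : ℝ :=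
  16 * R₀ / Real.sqrt m * (R₀ + Real.sqrt (Real.log (1 / δ)) + Real.sqrt (d * Real.log m))

/-- The initialization event `A₀`:
`sup_{‖x‖ = 1} (R₀/m) ∑ᵢ 𝟙{|⟨θᵢ(0), x⟩| ≤ R₀/√m} ≤ ρ₀(R₀,m,δ)`, with `m = k + k`. -/
def initEvent (k d : ℕ) (R₀ δ : ℝ) : Set (Init k d) :=
  {w | ∀ x : E d, ‖x‖ = 1 →
    R₀ / ((k + k : ℕ) : ℝ) * ∑ i : Fin (k + k),
      (if |inner ℝ (w.θ i) x| ≤ R₀ / Real.sqrt ((k + k : ℕ) : ℝ) then (1 : ℝ) else 0)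
    ≤ rho d R₀ (k + k) δ}

section Algorithm

variable {S A : Type*} [MeasurableSpace S] [Fintype A] [Nonempty A] [MeasurableSpace A]
variable {d m : ℕ}

/-- Softmax policy `π_θ(a|s) ∝ exp f(s,a;(c,θ))`. -/
def softmaxPolicy (M : MDP S A d) (c : Fin m → ℝ) (θ : Weights m d) : Policy S A where
  prob s a := Real.exp (net c θ (M.feat s a)) / ∑ a', Real.exp (net c θ (M.feat s a'))
  meas a := by
    have h : ∀ a, Measurable fun s => Real.exp (net c θ (M.feat s a)) := fun a => by
      have := M.feat_meas a
      unfold net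
      fun_prop
    exact (h a).div (Finset.measurable_sum _ fun a _ => h a)
  nonneg s a := by positivity
  sum_one s := by
    rw [← Finset.sum_div]
    exact div_self (Finset.sum_pos (fun a _ => Real.exp_pos _) Finset.univ_nonempty).ne'

/-- `∇_θ log π_θ(a|s) = ∇f(s,a) - ∑_{a'} π_θ(a'|s) ∇f(s,a')`. -/
def logPolicyGrad (M : MDP S A d) (c : Fin m → ℝ) (θ : Weights m d) (s : S) (a : A) :
    Weights m d :=
  netGrad c θ (M.feat s a) -
    ∑ a', (softmaxPolicy M c θ).prob s a' • netGrad c θ (M.feat s a')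

/-! ### The actor-critic algorithm -/

/-- Euclidean projection: a point of `C` nearest to `x`. -/
def proj {F : Type*} [NormedAddCommGroup F] (C : Set F) (x : F) : F :=
  Classical.epsilon fun y => y ∈ C ∧ ∀ z ∈ C, ‖x - y‖ ≤ ‖x - z‖

theorem proj_spec {F : Type*} [NormedAddCommGroup F] {C : Set F} (hC : IsCompact C)
    (hne : C.Nonempty) (x : F) : proj C x ∈ C ∧ ∀ z ∈ C, ‖x - proj C x‖ ≤ ‖x - z‖ := by
  obtain ⟨y, hy, hmin⟩ := hC.exists_isMinOn hne
    (f := fun y => ‖x - y‖) (by fun_prop)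
  exact Classical.epsilon_spec (p := fun y => y ∈ C ∧ ∀ z ∈ C, ‖x - y‖ ≤ ‖x - z‖)
    ⟨y, hy, fun z hz => hmin hz⟩

/-- `𝓑_{m,R}^d(v) = {y : supᵢ ‖vᵢ - yᵢ‖ ≤ R/√m}`. -/
def rowBall (v : Weights m d) (R : ℝ) : Set (Weights m d) :=
  {y | ∀ i, ‖v i - y i‖ ≤ R / Real.sqrt m}

/-- Parameters: projection radius, regularization coefficient, SGD and TD step-sizes,
numbers of SGD and TD iterations, policy step-sizes. -/
structure Params where
  R : ℝ
  lam : ℝ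
  αA : ℝ
  αC : ℝ
  N : ℕ
  T' : ℕ
  η : ℕ → ℝ

/-- Realization of the randomness used by the algorithm after the actor initialization: in outer
iteration `t`, the critic initialization, the TD samples `(s_j, a_j, s_j', a_j')`, and the SGD
samples `(s_n, a_n)`. -/
structure Realization (S A : Type*) (k' d : ℕ) where
  criticInit : ℕ → Init k' d
  tdS : ℕ → ℕ → S
  tdA : ℕ → ℕ → A
  tdS' : ℕ → ℕ → S
  tdA' : ℕ → ℕ → A
  sgdS : ℕ → ℕ → S
  sgdA : ℕ → ℕ → A

variable {k k' : ℕ} (M : MDP S A d) (p : Params) (w : Init k d) (ζ : Realization S A k' d)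

/-- Critic weights `W(j)` of max-norm regularized neural TD learning in outer iteration `t`. -/
def tdWeights (π : Policy S A) (t : ℕ) : ℕ → Weights (k' + k') d
  | 0 => (ζ.criticInit t).θ
  | j + 1 =>
    let b := (ζ.criticInit t).c
    let W := tdWeights π t j
    let x := M.feat (ζ.tdS t j) (ζ.tdA t j)
    let x' := M.feat (ζ.tdS' t j) (ζ.tdA' t j)
    let reward := M.r (ζ.tdS t j) (ζ.tdA t j)
      - p.lam * Real.log (π.prob (ζ.tdS t j) (ζ.tdA t j))
    let err := reward + M.γ * net b W x' - net b W x
    WithLp.toLp 2 fun i =>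
      proj (Metric.closedBall ((ζ.criticInit t).θ i) (p.R / Real.sqrt ((k' + k' : ℕ) : ℝ)))
        (W i + (p.αC * err) • netGrad b W x i)

/-- Critic estimate of the soft Q-function. -/
def criticQ (π : Policy S A) (t : ℕ) (s : S) (a : A) : ℝ :=
  net (ζ.criticInit t).c ((p.T' : ℝ)⁻¹ • ∑ j ∈ Finset.range p.T', tdWeights M p ζ π t j)
    (M.feat s a) - p.lam * Real.log (π.prob s a)

/-- Critic estimate of the soft advantage function. -/
def criticAdv (π : Policy S A) (t : ℕ) (s : S) (a : A) : ℝ :=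
  criticQ M p ζ π t s a - ∑ a', π.prob s a' * criticQ M p ζ π t s a'

/-- Projected SGD iterates `u_n^{(t)}` when the actor weights are `θ`. -/
def sgdIterate (θ : Weights (k + k) d) (t : ℕ) : ℕ → Weights (k + k) d
  | 0 => 0
  | n + 1 =>
    let u := sgdIterate θ t n
    let s := ζ.sgdS t n
    let a := ζ.sgdA t n
    let g := logPolicyGrad M w.c θ s a
    proj (rowBall 0 p.R)
      (u - (p.αA * (inner ℝ g u - criticAdv M p ζ (softmaxPolicy M w.c θ) t s a)) • g)

/-- `u_t = (1/N) ∑_{n=1}^N u_n^{(t)}` when the actor weights are `θ`. -/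
def sgdAverage (θ : Weights (k + k) d) (t : ℕ) : Weights (k + k) d :=
  (p.N : ℝ)⁻¹ • ∑ n ∈ Finset.Icc 1 p.N, sgdIterate M p w ζ θ t n

/-- Actor weights `θ(t)`:
`θ(t+1) = θ(t) + η_t u_t - η_t λ (θ(t) - θ(0))`. -/
def actorWeights : ℕ → Weights (k + k) d
  | 0 => w.θ
  | t + 1 =>
    let θ := actorWeights t
    θ + p.η t • sgdAverage M p w ζ θ t - (p.η t * p.lam) • (θ - w.θ)

/-- The policy `π_t`. -/
def policyAt (t : ℕ) : Policy S A := softmaxPolicy M w.c (actorWeights M p w ζ t)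

/-- The update direction `u_t`. -/
def direction (t : ℕ) : Weights (k + k) d :=
  sgdAverage M p w ζ (actorWeights M p w ζ t) t

/-- The fitting error `∇ᵀf₀(s,a) u_t - Q_λ^{π_t}(s,a)`. -/
def fitError (t : ℕ) (s : S) (a : A) : ℝ :=
  inner ℝ (netGrad w.c w.θ (M.feat s a)) (direction M p w ζ t)
    - M.Q p.lam (policyAt M p w ζ t) s a

end Algorithm

end NeuralNAC

end

set_option linter.unusedSectionVars false

namespace NeuralNAC

/-! ### Trajectories of time-homogeneous Markov chains -/

/-! Write `h = ⟨∇f₀, u_t⟩` for the linear prediction, `f`, `f'` for the networks at times `t`,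
`t+1`, and `Z`, `Z'` for their softmax normalizers. The relative entropy to a softmax policy is
`-H(π*) - E_{π*} f + log Z`, so its drift is `log (Z'/Z) - E_{π*}(f' - f)`. Since `Z'/Z = E_{π_t}
exp(f' - f)`, Hoeffding's lemma replaces `log (Z'/Z)` by `E_{π_t}(f' - f)`. One update moves each
row by at most `2ηR/√m`, hence the network output by at most `2ηR`, and the price is `(2ηR)²/2 =
2η²R²`.

The decay towards `θ(0)` makes `θ(t+1) - θ(0)` a convex combination of `θ(t) - θ(0)` and `u_t/λ`.
All rows therefore stay within `(R/λ)/√m` of their start, where on `A₀` the network agrees with its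
linearization at `θ(0)` up to `ρ₀`. The symmetric initialization makes the network vanish at `θ(0)`,
so `f' = (1 - ηλ) f + η h` up to `2ρ₀`. In the difference of the two averages the term `-ηλ f`
yields `-ηλ KL` and an entropy difference. With `h` split as fitting error plus `Q`, what remains is
the soft advantage of `π*` over `π_t`, which the performance difference identity
(`MDP.performance_difference`) integrates to `(1 - γ)Δ_t`. The total linearization cost is `4ρ₀`.
The pointwise estimate is `kl_policyAt_succ_sub_le`, the integrated one
`potential_policyAt_succ_sub_le`. The critic and the samples enter only through `u_t`, whose rows
are bounded by the projection.

For the probability of `A₀` (`symInit_initEvent_ge`), a fixed unit vector is nearly orthogonal to a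
Gaussian row with small probability, and Hoeffding's inequality controls the number of such rows. A
finite net of the sphere and a union bound make this uniform; passing from a point to its neighbour
in the net is harmless for rows of norm at most `√m`, and longer rows are simply counted as bad. -/

theorem integral_trajMeasure_zero {X : Type*} [MeasurableSpace X] (μ₀ : Measure X)
    [IsProbabilityMeasure μ₀]
    (κ : (n : ℕ) → Kernel ((i : Finset.Iic n) → X) X) [∀ n, IsMarkovKernel (κ n)]
    {g : X → ℝ} (hg : Measurable g) :
    ∫ ω, g (ω 0) ∂(Kernel.trajMeasure (X := fun _ => X) μ₀ κ) = ∫ x, g x ∂μ₀ := by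
  have h : (Kernel.trajMeasure (X := fun _ => X) μ₀ κ).map (Preorder.frestrictLe 0)
      = μ₀.map (MeasurableEquiv.piUnique _).symm := by
    rw [Kernel.trajMeasure, Measure.map_comp _ _ (by fun_prop), Kernel.traj_map_frestrictLe,
      Kernel.partialTraj_self, Measure.id_comp]
  have hm : Measurable fun y : (i : Finset.Iic 0) → X => g (y ⟨0, Finset.mem_Iic.2 le_rfl⟩) := by
    fun_prop
  have e : ∫ ω, g (ω 0) ∂(Kernel.trajMeasure (X := fun _ => X) μ₀ κ)
      = ∫ y, g (y ⟨0, Finset.mem_Iic.2 le_rfl⟩)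
        ∂((Kernel.trajMeasure (X := fun _ => X) μ₀ κ).map (Preorder.frestrictLe 0)) := by
    rw [integral_map (by fun_prop) hm.aestronglyMeasurable]
    rfl
  rw [e, h, integral_map (by fun_prop) hm.aestronglyMeasurable]
  rfl

theorem integral_trajMeasure_succ {X : Type*} [MeasurableSpace X] (μ₀ : Measure X)
    [IsProbabilityMeasure μ₀] (K : Kernel X X) [IsMarkovKernel K]
    (n : ℕ) {g : X → ℝ} (hg : Measurable g) {C : ℝ} (hC : ∀ x, |g x| ≤ C) :
    ∫ ω, g (ω (n + 1)) ∂(Kernel.trajMeasure (X := fun _ => X) μ₀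
        fun n => K.comap (fun h => h ⟨n, Finset.mem_Iic.2 le_rfl⟩) (by fun_prop))
      = ∫ ω, ∫ y, g y ∂(K (ω n)) ∂(Kernel.trajMeasure (X := fun _ => X) μ₀
        fun n => K.comap (fun h => h ⟨n, Finset.mem_Iic.2 le_rfl⟩) (by fun_prop)) := by
  set κ : (n : ℕ) → Kernel ((i : Finset.Iic n) → X) X :=
    fun n => K.comap (fun h => h ⟨n, Finset.mem_Iic.2 le_rfl⟩) (by fun_prop)
  have h := Kernel.map_frestrictLe_trajMeasure_compProd_eq_map_trajMeasure
    (X := fun _ => X) (μ₀ := μ₀) (κ := κ) (a := n)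
  have hg2 : Measurable fun y : ((i : Finset.Iic n) → X) × X => g y.2 := by fun_prop
  have e : ∫ ω, g (ω (n + 1)) ∂(Kernel.trajMeasure (X := fun _ => X) μ₀ κ)
      = ∫ y, g y.2 ∂((Kernel.trajMeasure (X := fun _ => X) μ₀ κ).map
          fun x => (Preorder.frestrictLe n x, x (n + 1))) := by
    rw [integral_map (by fun_prop) hg2.aestronglyMeasurable]
  rw [e, ← h]
  have hK : Measurable fun x => ∫ y, g y ∂(K x) :=
    (hg.stronglyMeasurable.integral_kernel (κ := K)).measurable
  have : IsProbabilityMeasure ((Kernel.trajMeasure (X := fun _ => X) μ₀ κ).map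
      (Preorder.frestrictLe n)) := Measure.isProbabilityMeasure_map (by fun_prop)
  rw [Measure.integral_compProd (Integrable.of_bound hg2.aestronglyMeasurable C
    (ae_of_all _ fun x => hC _))]
  have hm : Measurable fun h : (i : Finset.Iic n) → X => ∫ y, g y ∂(κ n h) :=
    hK.comp (measurable_pi_apply (⟨n, Finset.mem_Iic.2 le_rfl⟩ : Finset.Iic n))
  rw [integral_map (by fun_prop) hm.aestronglyMeasurable]
  rfl

theorem abs_integral_le_of_abs_le {X : Type*} [MeasurableSpace X] (ν : Measure X)
    [IsProbabilityMeasure ν] {v : X → ℝ} {C : ℝ} (hC : ∀ x, |v x| ≤ C) :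
    |∫ x, v x ∂ν| ≤ C := by
  have := norm_integral_le_of_norm_le_const (μ := ν) (f := v) (C := C) (ae_of_all _ hC)
  simpa using this

theorem summable_discount {γ : ℝ} (h0 : 0 ≤ γ) (h1 : γ < 1) {x : ℕ → ℝ} {C : ℝ}
    (hC : ∀ n, |x n| ≤ C) : Summable fun n => γ ^ n * x n := by
  refine Summable.of_norm_bounded ((summable_geometric_of_lt_one h0 h1).mul_right C) fun n => ?_
  rw [Real.norm_eq_abs, abs_mul, abs_of_nonneg (pow_nonneg h0 n)]
  exact mul_le_mul_of_nonneg_left (hC n) (pow_nonneg h0 n)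

theorem abs_tsum_discount_le {γ : ℝ} (h0 : 0 ≤ γ) (h1 : γ < 1) {x : ℕ → ℝ} {C : ℝ}
    (hC : ∀ n, |x n| ≤ C) : |∑' n, γ ^ n * x n| ≤ (1 - γ)⁻¹ * C := by
  rw [← tsum_geometric_of_lt_one h0 h1, ← tsum_mul_right]
  rw [← Real.norm_eq_abs]
  refine tsum_of_norm_bounded ((summable_geometric_of_lt_one h0 h1).mul_right C).hasSum fun n => ?_
  rw [Real.norm_eq_abs, abs_mul, abs_of_nonneg (pow_nonneg h0 n)]
  exact mul_le_mul_of_nonneg_left (hC n) (pow_nonneg h0 n)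

theorem integral_tsum_discount {X : Type*} [MeasurableSpace X] (ν : Measure X)
    [IsProbabilityMeasure ν] {γ : ℝ} (h0 : 0 ≤ γ) (h1 : γ < 1) {F : ℕ → X → ℝ}
    (hF : ∀ n, Measurable (F n)) {C : ℝ} (hC : ∀ n x, |F n x| ≤ C) :
    ∫ x, ∑' n, γ ^ n * F n x ∂ν = ∑' n, γ ^ n * ∫ x, F n x ∂ν := by
  have hi : ∀ n, Integrable (fun x => γ ^ n * F n x) ν := fun n =>
    (Integrable.of_bound (hF n).aestronglyMeasurable C (ae_of_all _ (hC n))).const_mul _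
  rw [← integral_tsum_of_summable_integral_norm hi]
  · simp_rw [integral_const_mul]
  · refine Summable.of_norm_bounded ((summable_geometric_of_lt_one h0 h1).mul_right C) fun n => ?_
    rw [Real.norm_eq_abs]
    refine abs_integral_le_of_abs_le ν fun x => ?_
    rw [abs_norm, Real.norm_eq_abs, abs_mul, abs_of_nonneg (pow_nonneg h0 n)]
    exact mul_le_mul_of_nonneg_left (hC n x) (pow_nonneg h0 n)

/-! ### Bounded measurable functions -/

/-- Bounded measurable real functions. -/
def BddMeas {S : Type*} [MeasurableSpace S] (v : S → ℝ) : Prop :=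
  Measurable v ∧ ∃ C, ∀ s, |v s| ≤ C

namespace BddMeas

variable {S : Type*} [MeasurableSpace S] {v w : S → ℝ}

theorem integrable (hv : BddMeas v) (ν : Measure S) [IsFiniteMeasure ν] : Integrable v ν := by
  obtain ⟨hm, C, hC⟩ := hv
  exact Integrable.of_bound hm.aestronglyMeasurable C (ae_of_all _ hC)

theorem const (c : ℝ) : BddMeas fun _ : S => c := ⟨measurable_const, |c|, fun _ => le_rfl⟩

theorem add (hv : BddMeas v) (hw : BddMeas w) : BddMeas fun s => v s + w s := by
  obtain ⟨hm, C, hC⟩ := hv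
  obtain ⟨hm', C', hC'⟩ := hw
  exact ⟨hm.add hm', C + C', fun s => (abs_add_le _ _).trans (add_le_add (hC s) (hC' s))⟩

theorem mul (hv : BddMeas v) (hw : BddMeas w) : BddMeas fun s => v s * w s := by
  obtain ⟨hm, C, hC⟩ := hv
  obtain ⟨hm', C', hC'⟩ := hw
  refine ⟨hm.mul hm', C * C', fun s => ?_⟩
  rw [abs_mul]
  exact mul_le_mul (hC s) (hC' s) (abs_nonneg _) ((abs_nonneg _).trans (hC s))

theorem const_mul (hv : BddMeas v) (c : ℝ) : BddMeas fun s => c * v s := (const c).mul hv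

theorem neg (hv : BddMeas v) : BddMeas fun s => -v s :=
  ⟨hv.1.neg, hv.2.imp fun C hC s => by rw [abs_neg]; exact hC s⟩

theorem sub (hv : BddMeas v) (hw : BddMeas w) : BddMeas fun s => v s - w s := by
  simpa [sub_eq_add_neg] using hv.add hw.neg

theorem sum {ι : Type*} (I : Finset ι) {f : ι → S → ℝ} (hf : ∀ i, BddMeas (f i)) :
    BddMeas fun s => ∑ i ∈ I, f i s := by
  classical
  induction I using Finset.induction_on with
  | empty => simpa using const 0
  | insert i I hi ih =>
    simp_rw [Finset.sum_insert hi]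
    exact (hf i).add ih

theorem integral_kernel {X : Type*} [MeasurableSpace X] {v : X → ℝ} (hv : BddMeas v)
    (K : Kernel S X) [IsMarkovKernel K] : BddMeas fun s => ∫ x, v x ∂(K s) :=
  ⟨(hv.1.stronglyMeasurable.integral_kernel (κ := K)).measurable,
    hv.2.imp fun _ hC s => abs_integral_le_of_abs_le (K s) hC⟩

theorem tsum_discount {γ : ℝ} (h0 : 0 ≤ γ) (h1 : γ < 1) {F : ℕ → S → ℝ}
    (hF : ∀ n, Measurable (F n)) {C : ℝ} (hC : ∀ n x, |F n x| ≤ C) :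
    BddMeas fun s => ∑' n, γ ^ n * F n s :=
  ⟨Measurable.tsum fun n => (hF n).const_mul _, (1 - γ)⁻¹ * C,
    fun s => abs_tsum_discount_le h0 h1 fun n => hC n s⟩

end BddMeas

/-! ### Value functions and the performance difference identity -/

section Policies

variable {S A : Type*} [MeasurableSpace S] [Fintype A]

theorem Policy.prob_le_one (π : Policy S A) (s : S) (a : A) : π.prob s a ≤ 1 := by
  rw [← π.sum_one s]
  exact Finset.single_le_sum (fun a _ => π.nonneg s a) (Finset.mem_univ a)

theorem Policy.bddMeas_prob (π : Policy S A) (a : A) : BddMeas fun s => π.prob s a :=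
  ⟨π.meas a, 1, fun s => by rw [abs_of_nonneg (π.nonneg s a)]; exact π.prob_le_one s a⟩

theorem bddMeas_mul_log {p : S → ℝ} (hp : Measurable p) (h0 : ∀ s, 0 ≤ p s) (h1 : ∀ s, p s ≤ 1) :
    BddMeas fun s => p s * Real.log (p s) := by
  refine ⟨hp.mul hp.log, 1, fun s => ?_⟩
  rcases (h0 s).eq_or_lt with h | h
  · simp [← h]
  · change |p s * Real.log (p s)| ≤ 1
    rw [mul_comm]
    exact (Real.abs_log_mul_self_lt _ h (h1 s)).le

theorem Policy.bddMeas_entropy (π : Policy S A) : BddMeas π.entropy :=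
  (BddMeas.sum _ fun a => bddMeas_mul_log (π.meas a) (fun s => π.nonneg s a)
    fun s => π.prob_le_one s a).neg

/-- `E_{a ∼ π(·|s)}[g(s,a)]`. -/
noncomputable def Policy.avg (π : Policy S A) (g : S → A → ℝ) (s : S) : ℝ := ∑ a, π.prob s a * g s a

theorem Policy.bddMeas_avg (π : Policy S A) {g : S → A → ℝ} (hg : ∀ a, BddMeas fun s => g s a) :
    BddMeas (π.avg g) :=
  BddMeas.sum _ fun a => (π.bddMeas_prob a).mul (hg a)

theorem Policy.avg_const (π : Policy S A) (v : S → ℝ) : π.avg (fun s _ => v s) = v := by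
  funext s
  simp [Policy.avg, ← Finset.sum_mul, π.sum_one]

theorem Policy.abs_avg_le (π : Policy S A) {g : S → A → ℝ} {C : ℝ} {s : S}
    (hC : ∀ a, |g s a| ≤ C) : |π.avg g s| ≤ C := by
  calc |π.avg g s| ≤ ∑ a, |π.prob s a * g s a| := Finset.abs_sum_le_sum_abs _ _
    _ ≤ ∑ a, π.prob s a * C := by
      refine Finset.sum_le_sum fun a _ => ?_
      rw [abs_mul, abs_of_nonneg (π.nonneg s a)]
      exact mul_le_mul_of_nonneg_left (hC a) (π.nonneg s a)
    _ = C := by rw [← Finset.sum_mul, π.sum_one, one_mul]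

variable [MeasurableSpace A]

theorem Policy.integral_kernel [MeasurableSingletonClass A] (π : Policy S A) (g : A → ℝ) (s : S) :
    ∫ a, g a ∂(π.kernel s) = ∑ a, π.prob s a * g a := by
  change ∫ a, g a ∂(∑ a, ENNReal.ofReal (π.prob s a) • Measure.dirac a : Measure A) = _
  rw [integral_finsetSum_measure]
  · refine Finset.sum_congr rfl fun a _ => ?_
    rw [integral_smul_measure, integral_dirac, ENNReal.toReal_ofReal (π.nonneg s a), smul_eq_mul]
  · intro a _
    exact (integrable_dirac (by simp)).smul_measure ENNReal.ofReal_ne_top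

namespace MDP

variable {d : ℕ} (M : MDP S A d) (π : Policy S A)

/-- Transition operator `(T_π v)(s) = E_{a ∼ π(·|s), s' ∼ P(·|s,a)}[v(s')]`. -/
noncomputable def transOp (v : S → ℝ) : S → ℝ := π.avg fun s a => ∫ s', v s' ∂(M.P (s, a))

theorem bddMeas_integral_P {v : S → ℝ} (hv : BddMeas v) (a : A) :
    BddMeas fun s => ∫ s', v s' ∂(M.P (s, a)) :=
  hv.integral_kernel (M.P.comap (fun s => (s, a)) (by fun_prop))

theorem bddMeas_transOp {v : S → ℝ} (hv : BddMeas v) : BddMeas (M.transOp π v) :=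
  π.bddMeas_avg fun a => M.bddMeas_integral_P hv a

theorem abs_transOp_le {v : S → ℝ} {C : ℝ} (hC : ∀ s, |v s| ≤ C) (s : S) :
    |M.transOp π v s| ≤ C :=
  π.abs_avg_le fun _ => abs_integral_le_of_abs_le _ hC

theorem bddMeas_transOp_iterate {v : S → ℝ} (hv : BddMeas v) (n : ℕ) :
    BddMeas ((M.transOp π)^[n] v) := by
  induction n with
  | zero => exact hv
  | succ n ih =>
    rw [Function.iterate_succ_apply']
    exact M.bddMeas_transOp π ih

theorem abs_transOp_iterate_le {v : S → ℝ} {C : ℝ} (hC : ∀ s, |v s| ≤ C) (n : ℕ) (s : S) :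
    |(M.transOp π)^[n] v s| ≤ C := by
  induction n generalizing s with
  | zero => exact hC s
  | succ n ih =>
    rw [Function.iterate_succ_apply']
    exact M.abs_transOp_le π ih s

/-- The single shape `v + c * w` serves three uses below: the entropy weight `c = λ`, the discount
`c = γ`, and subtraction with `c = -1`. -/
theorem transOp_add_const_mul {v w : S → ℝ} (hv : BddMeas v) (hw : BddMeas w) (c : ℝ) :
    M.transOp π (fun s => v s + c * w s) = fun s => M.transOp π v s + c * M.transOp π w s := by
  funext s
  simp only [transOp, Policy.avg]
  rw [Finset.mul_sum, ← Finset.sum_add_distrib]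
  refine Finset.sum_congr rfl fun a _ => ?_
  rw [integral_add (hv.integrable _) ((hw.const_mul c).integrable _), integral_const_mul]
  ring

theorem transOp_iterate_add_const_mul {v w : S → ℝ} (hv : BddMeas v) (hw : BddMeas w) (c : ℝ)
    (n : ℕ) : (M.transOp π)^[n] (fun s => v s + c * w s)
      = fun s => (M.transOp π)^[n] v s + c * (M.transOp π)^[n] w s := by
  induction n with
  | zero => rfl
  | succ n ih =>
    simp only [Function.iterate_succ_apply']
    rw [ih, M.transOp_add_const_mul π (M.bddMeas_transOp_iterate π hv n)
      (M.bddMeas_transOp_iterate π hw n)]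

theorem measurable_of_forall_action [MeasurableSingletonClass A] {g : S → A → ℝ}
    (hg : ∀ a, Measurable fun s => g s a) : Measurable fun z : S × A => g z.1 z.2 :=
  measurable_from_prod_countable_left fun a => hg a

theorem integral_step [MeasurableSingletonClass A]
    {g : S → A → ℝ} (hg : ∀ a, Measurable fun s => g s a) {C : ℝ}
    (hC : ∀ s a, |g s a| ≤ C) (z : S × A) :
    ∫ y, g y.1 y.2 ∂(M.step π z) = ∫ s', π.avg g s' ∂(M.P z) := by
  have hm := measurable_of_forall_action hg
  unfold step
  rw [integral_compProd (Integrable.of_bound hm.aestronglyMeasurable C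
    (ae_of_all _ fun y => hC _ _))]
  simp_rw [Kernel.prodMkLeft_apply, π.integral_kernel]
  rfl

theorem integral_pathLaw [MeasurableSingletonClass A]
    (ν : Measure S) [IsProbabilityMeasure ν] {g : S → A → ℝ}
    (hg : ∀ a, Measurable fun s => g s a) {C : ℝ} (hC : ∀ s a, |g s a| ≤ C) (n : ℕ) :
    ∫ ω, g (ω n).1 (ω n).2 ∂(M.pathLaw π ν) = ∫ s, (M.transOp π)^[n] (π.avg g) s ∂ν := by
  induction n generalizing g with
  | zero =>
    have hm := measurable_of_forall_action hg
    rw [pathLaw, integral_trajMeasure_zero _ _ hm, Measure.integral_compProd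
      (Integrable.of_bound hm.aestronglyMeasurable C (ae_of_all _ fun y => hC _ _))]
    simp_rw [π.integral_kernel]
    rfl
  | succ n ih =>
    have hm := measurable_of_forall_action hg
    rw [pathLaw, integral_trajMeasure_succ _ _ n hm (fun x => hC x.1 x.2)]
    simp_rw [M.integral_step π hg hC]
    have hb : BddMeas (π.avg g) := π.bddMeas_avg fun a => ⟨hg a, C, fun s => hC s a⟩
    -- Conditioning on time `n` turns `g` at time `n + 1` into this function at time `n`; its
    -- average over `π` is `M.transOp π (π.avg g)` by definition, so the new operator sits innermost
    -- in the iterate.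
    have := ih (g := fun s a => ∫ s', π.avg g s' ∂(M.P (s, a)))
      (fun a => (M.bddMeas_integral_P hb a).1)
      (fun s a => abs_integral_le_of_abs_le _ fun s' => π.abs_avg_le fun a => hC s' a)
    rw [Function.iterate_succ_apply]
    exact this

/-- Discounted value of the state cost `v` along the chain of `π`. -/
noncomputable def discValue (v : S → ℝ) (s : S) : ℝ := ∑' n, M.γ ^ n * (M.transOp π)^[n] v s

theorem bddMeas_discValue {v : S → ℝ} (hv : BddMeas v) : BddMeas (M.discValue π v) := by
  obtain ⟨C, hC⟩ := hv.2
  exact BddMeas.tsum_discount M.γ_pos.le M.γ_lt_one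
    (fun n => (M.bddMeas_transOp_iterate π hv n).1) fun n s => M.abs_transOp_iterate_le π hC n s

theorem integral_discValue (ν : Measure S) [IsProbabilityMeasure ν] {v : S → ℝ} (hv : BddMeas v) :
    ∫ s, M.discValue π v s ∂ν = ∑' n, M.γ ^ n * ∫ s, (M.transOp π)^[n] v s ∂ν := by
  obtain ⟨C, hC⟩ := hv.2
  exact integral_tsum_discount ν M.γ_pos.le M.γ_lt_one
    (fun n => (M.bddMeas_transOp_iterate π hv n).1) fun n s => M.abs_transOp_iterate_le π hC n s

/-- Bellman equation: the term `n = 0` is split off, and the one-step operator passes through the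
series because the discounted terms are absolutely summable. -/
theorem discValue_eq_add {v : S → ℝ} (hv : BddMeas v) (s : S) :
    M.discValue π v s = v s + M.γ * M.transOp π (M.discValue π v) s := by
  obtain ⟨C, hC⟩ := hv.2
  have hsum : ∀ s, Summable fun n => M.γ ^ n * (M.transOp π)^[n] v s := fun s =>
    summable_discount M.γ_pos.le M.γ_lt_one fun n => M.abs_transOp_iterate_le π hC n s
  have hT : M.transOp π (M.discValue π v) s
      = ∑' n, M.γ ^ n * (M.transOp π)^[n + 1] v s := by
    simp only [transOp, Policy.avg]
    have h1 : ∀ a, π.prob s a * ∫ s', M.discValue π v s' ∂(M.P (s, a))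
        = ∑' n, M.γ ^ n * (π.prob s a * ∫ s', (M.transOp π)^[n] v s' ∂(M.P (s, a))) := by
      intro a
      rw [M.integral_discValue π _ hv, ← tsum_mul_left]
      exact tsum_congr fun n => by ring
    simp_rw [h1]
    rw [← Summable.tsum_finsetSum]
    · refine tsum_congr fun n => ?_
      rw [Function.iterate_succ_apply', ← Finset.mul_sum]
      rfl
    · intro a _
      refine summable_discount M.γ_pos.le M.γ_lt_one (C := C) fun n => ?_
      rw [abs_mul, abs_of_nonneg (π.nonneg s a)]
      exact (mul_le_of_le_one_left (abs_nonneg _) (π.prob_le_one s a)).trans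
        (abs_integral_le_of_abs_le _ fun s' => M.abs_transOp_iterate_le π hC n s')
  rw [hT, ← tsum_mul_left, discValue, (hsum s).tsum_eq_zero_add]
  simp only [pow_zero, one_mul, Function.iterate_zero, id_eq, pow_succ]
  congr 1
  exact tsum_congr fun n => by ring

/-- The regularized expected one-step reward `E_{a ∼ π(·|s)}[r(s,a)] + λ 𝓗(π(·|s))`. -/
noncomputable def regReward (lam : ℝ) (s : S) : ℝ := π.avg M.r s + lam * π.entropy s

theorem bddMeas_r (a : A) : BddMeas fun s => M.r s a :=
  ⟨M.r_meas a, M.rmax, fun s => by rw [abs_of_nonneg (M.r_nonneg s a)]; exact M.r_le s a⟩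

theorem bddMeas_regReward (lam : ℝ) : BddMeas (M.regReward π lam) :=
  (π.bddMeas_avg M.bddMeas_r).add (π.bddMeas_entropy.const_mul lam)

instance isProbabilityMeasure_pathLaw (ν : Measure S) [IsProbabilityMeasure ν] :
    IsProbabilityMeasure (M.pathLaw π ν) := by
  unfold pathLaw; infer_instance

theorem integral_pathLaw_dirac_tsum [MeasurableSingletonClass A]
    {g : S → A → ℝ} (hg : ∀ a, Measurable fun s => g s a) {C : ℝ}
    (hC : ∀ s a, |g s a| ≤ C) (s : S) :
    ∫ ω, ∑' t : ℕ, M.γ ^ t * g (ω t).1 (ω t).2 ∂(M.pathLaw π (Measure.dirac s))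
      = M.discValue π (π.avg g) s := by
  have hm := measurable_of_forall_action hg
  have h := integral_tsum_discount (M.pathLaw π (Measure.dirac s)) M.γ_pos.le M.γ_lt_one
    (F := fun t ω => g (ω t).1 (ω t).2) (fun n => hm.comp (measurable_pi_apply n))
    (C := C) (fun n ω => hC _ _)
  refine h.trans ?_
  refine tsum_congr fun n => ?_
  rw [M.integral_pathLaw π _ hg hC, integral_dirac']
  exact (M.bddMeas_transOp_iterate π
    (π.bddMeas_avg fun a => ⟨hg a, C, fun s => hC s a⟩) n).1.stronglyMeasurable

/-- Replaces path integrals by a series of operator iterates, so that later arguments on value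
functions need no trajectory measure. -/
theorem Vreg_eq_discValue [MeasurableSingletonClass A]
    (lam : ℝ) : M.Vreg lam π = M.discValue π (M.regReward π lam) := by
  funext s
  obtain ⟨C, hC⟩ := π.bddMeas_entropy.2
  have hr := π.bddMeas_avg M.bddMeas_r
  have h1 : M.V π s = M.discValue π (π.avg M.r) s :=
    M.integral_pathLaw_dirac_tsum π M.r_meas (C := M.rmax)
      (fun s a => by rw [abs_of_nonneg (M.r_nonneg s a)]; exact M.r_le s a) s
  have h2 : M.H π s = M.discValue π π.entropy s := by
    have := M.integral_pathLaw_dirac_tsum π (g := fun s _ => π.entropy s)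
      (fun _ => π.bddMeas_entropy.1) (fun s _ => hC s) s
    rwa [π.avg_const] at this
  obtain ⟨C', hC'⟩ := hr.2
  rw [Vreg, h1, h2, discValue, discValue, discValue, ← tsum_mul_left, ← Summable.tsum_add]
  · refine tsum_congr fun n => ?_
    have := congrFun (M.transOp_iterate_add_const_mul π hr π.bddMeas_entropy lam n) s
    unfold regReward
    rw [this]
    ring
  · exact summable_discount M.γ_pos.le M.γ_lt_one fun n => M.abs_transOp_iterate_le π hC' n s
  · exact (summable_discount M.γ_pos.le M.γ_lt_one
      fun n => M.abs_transOp_iterate_le π hC n s).mul_left lam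

theorem bddMeas_Vreg [MeasurableSingletonClass A] (lam : ℝ) : BddMeas (M.Vreg lam π) := by
  rw [Vreg_eq_discValue]
  exact M.bddMeas_discValue π (M.bddMeas_regReward π lam)

theorem bddMeas_Q [MeasurableSingletonClass A] (lam : ℝ) (a : A) : BddMeas fun s => M.Q lam π s a :=
  (M.bddMeas_r a).add ((M.bddMeas_integral_P (M.bddMeas_Vreg π lam) a).const_mul _)

/-- Averaging the soft Q-function of `π` over the actions of another policy. -/
theorem avg_Q (lam : ℝ) (π' : Policy S A) (s : S) :
    π'.avg (M.Q lam π) s + lam * π'.entropy s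
      = M.regReward π' lam s + M.γ * M.transOp π' (M.Vreg lam π) s := by
  have h : π'.avg (M.Q lam π) s
      = π'.avg M.r s + M.γ * M.transOp π' (M.Vreg lam π) s := by
    simp only [Policy.avg, transOp, Q, Finset.mul_sum, ← Finset.sum_add_distrib]
    exact Finset.sum_congr rfl fun a _ => by ring
  rw [h, regReward]
  ring

theorem Vreg_eq_avg_Q [MeasurableSingletonClass A] (lam : ℝ) (s : S) :
    M.Vreg lam π s = π.avg (M.Q lam π) s + lam * π.entropy s := by
  rw [avg_Q, Vreg_eq_discValue]
  exact M.discValue_eq_add π (M.bddMeas_regReward π lam) s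

instance isProbabilityMeasure_visit (ν : Measure S) [IsProbabilityMeasure ν] :
    IsProbabilityMeasure (M.visit ν π) := by
  refine ⟨?_⟩
  have h : ∀ n : ℕ, (M.pathLaw π ν).map (fun ω => (ω n).1) Set.univ = 1 := fun n => by
    rw [Measure.map_apply (by fun_prop) MeasurableSet.univ, Set.preimage_univ, measure_univ]
  have hγ : 0 ≤ 1 - M.γ := by linarith [M.γ_lt_one]
  rw [visit, Measure.sum_apply _ MeasurableSet.univ]
  simp only [Measure.smul_apply, h, smul_eq_mul, mul_one]
  rw [← ENNReal.ofReal_tsum_of_nonneg (fun n => mul_nonneg hγ (pow_nonneg M.γ_pos.le n))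
    ((summable_geometric_of_lt_one M.γ_pos.le M.γ_lt_one).mul_left _), tsum_mul_left,
    tsum_geometric_of_lt_one M.γ_pos.le M.γ_lt_one, mul_inv_cancel₀ (by linarith [M.γ_lt_one]),
    ENNReal.ofReal_one]

theorem integral_visit [MeasurableSingletonClass A]
    (ν : Measure S) [IsProbabilityMeasure ν] {v : S → ℝ} (hv : BddMeas v) :
    ∫ s, v s ∂(M.visit ν π) = (1 - M.γ) * ∑' n, M.γ ^ n * ∫ s, (M.transOp π)^[n] v s ∂ν := by
  obtain ⟨C, hC⟩ := hv.2
  have hγ : 0 ≤ 1 - M.γ := by linarith [M.γ_lt_one]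
  have hi := hv.integrable (M.visit ν π)
  rw [visit] at hi ⊢
  rw [integral_sum_measure hi, ← tsum_mul_left]
  refine tsum_congr fun n => ?_
  rw [integral_smul_measure, ENNReal.toReal_ofReal (mul_nonneg hγ (pow_nonneg M.γ_pos.le n)),
    integral_map (Measurable.aemeasurable (by fun_prop)) hv.1.aestronglyMeasurable, smul_eq_mul,
    mul_assoc]
  congr 2
  have := M.integral_pathLaw π ν (g := fun s _ => v s) (fun _ => hv.1) (fun s _ => hC s) n
  rwa [π.avg_const] at this

/-- **Performance difference identity** for entropy-regularized value functions. -/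
theorem performance_difference [MeasurableSingletonClass A]
    (lam : ℝ) (μ : Measure S) [IsProbabilityMeasure μ]
    (π' : Policy S A) :
    ∫ s, (π'.avg (M.Q lam π) s + lam * π'.entropy s - M.Vreg lam π s) ∂(M.visit μ π')
      = (1 - M.γ) * (M.Vmean lam μ π' - M.Vmean lam μ π) := by
  set U := M.Vreg lam π with hU
  have hUb : BddMeas U := M.bddMeas_Vreg π lam
  have hcb := M.bddMeas_regReward π' lam
  simp_rw [avg_Q]
  rw [M.integral_visit π' μ ((hcb.add ((M.bddMeas_transOp π' hUb).const_mul _)).sub hUb)]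
  congr 1
  obtain ⟨CU, hCU⟩ := hUb.2
  obtain ⟨Cc, hCc⟩ := hcb.2
  have hV' : M.Vmean lam μ π'
      = ∑' n, M.γ ^ n * ∫ s, (M.transOp π')^[n] (M.regReward π' lam) s ∂μ := by
    rw [Vmean, Vreg_eq_discValue]
    exact M.integral_discValue π' μ hcb
  -- Telescoping: the term `γ T U` at index `n` is the term `U` at index `n + 1`, so after
  -- discounting and summing only the initial `U` survives, besides the value of `π'`.
  have hexp : ∀ n, ∫ s, (M.transOp π')^[n]
        (fun s => M.regReward π' lam s + M.γ * M.transOp π' U s - U s) s ∂μ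
      = ∫ s, (M.transOp π')^[n] (M.regReward π' lam) s ∂μ
        + M.γ * ∫ s, (M.transOp π')^[n + 1] U s ∂μ - ∫ s, (M.transOp π')^[n] U s ∂μ := by
    intro n
    have h1 := M.transOp_iterate_add_const_mul π'
      (hcb.add ((M.bddMeas_transOp π' hUb).const_mul M.γ))
      hUb (-1) n
    have h2 := M.transOp_iterate_add_const_mul π' hcb (M.bddMeas_transOp π' hUb) M.γ n
    have h3 : (fun s => M.regReward π' lam s + M.γ * M.transOp π' U s - U s)
        = fun s => M.regReward π' lam s + M.γ * M.transOp π' U s + -1 * U s := by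
      funext s; ring
    rw [h3, h1, h2]
    have i1 := M.bddMeas_transOp_iterate π' hcb n
    have i2 := M.bddMeas_transOp_iterate π' (M.bddMeas_transOp π' hUb) n
    have i3 := M.bddMeas_transOp_iterate π' hUb n
    rw [integral_add ((i1.add (i2.const_mul _)).integrable _) ((i3.const_mul _).integrable _),
      integral_add (i1.integrable _) ((i2.const_mul _).integrable _), integral_const_mul,
      integral_const_mul, Function.iterate_succ_apply]
    ring
  have sU : Summable fun n => M.γ ^ n * ∫ s, (M.transOp π')^[n] U s ∂μ :=
    summable_discount M.γ_pos.le M.γ_lt_one fun n =>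
      abs_integral_le_of_abs_le μ fun s => M.abs_transOp_iterate_le π' hCU n s
  have sc : Summable fun n => M.γ ^ n * ∫ s, (M.transOp π')^[n] (M.regReward π' lam) s ∂μ :=
    summable_discount M.γ_pos.le M.γ_lt_one fun n =>
      abs_integral_le_of_abs_le μ fun s => M.abs_transOp_iterate_le π' hCc n s
  have sU1 : Summable fun n => M.γ ^ (n + 1) * ∫ s, (M.transOp π')^[n + 1] U s ∂μ :=
    (summable_nat_add_iff 1).2 sU
  have h0 := sU.tsum_eq_zero_add
  simp only [pow_zero, one_mul, Function.iterate_zero, id_eq] at h0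
  have hVm : M.Vmean lam μ π = ∫ s, U s ∂μ := rfl
  have hterm : ∀ n, M.γ ^ n * ∫ s, (M.transOp π')^[n]
        (fun s => M.regReward π' lam s + M.γ * M.transOp π' U s - U s) s ∂μ
      = M.γ ^ n * ∫ s, (M.transOp π')^[n] (M.regReward π' lam) s ∂μ
        + M.γ ^ (n + 1) * ∫ s, (M.transOp π')^[n + 1] U s ∂μ
        - M.γ ^ n * ∫ s, (M.transOp π')^[n] U s ∂μ := fun n => by
    rw [hexp, pow_succ]; ring
  rw [tsum_congr hterm, (sc.add sU1).tsum_sub sU, sc.tsum_add sU1, ← hV', hVm]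
  linarith

end MDP

end Policies

/-! ### Linearization of two-layer networks -/

section Network

variable {m d : ℕ} {c : Fin m → ℝ} {θ θ' : Weights m d} {x : E d}

theorem inner_netGrad (c : Fin m → ℝ) (θ v : Weights m d) (x : E d) :
    inner ℝ (netGrad c θ x) v = 1 / Real.sqrt m *
      ∑ i, c i * ((if 0 ≤ inner ℝ (θ i) x then 1 else 0) * inner ℝ (v i) x) := by
  rw [PiLp.inner_apply, Finset.mul_sum]
  refine Finset.sum_congr rfl fun i _ => ?_
  change inner ℝ ((1 / Real.sqrt m * c i * if 0 ≤ inner ℝ (θ i) x then 1 else 0) • x) (v i) = _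
  rw [real_inner_smul_left, real_inner_comm (v i) x]
  ring

/-- Positive homogeneity of ReLU (Euler's identity). With the vanishing of the network at
initialization it removes `θ(0)` from the linearization. -/
theorem inner_netGrad_self (c : Fin m → ℝ) (θ : Weights m d) (x : E d) :
    inner ℝ (netGrad c θ x) θ = net c θ x := by
  rw [inner_netGrad, net]
  congr 1
  refine Finset.sum_congr rfl fun i _ => ?_
  split_ifs with h
  · rw [max_eq_right h, one_mul]
  · rw [max_eq_left (not_le.1 h).le, zero_mul]

theorem one_div_sqrt_mul_sum_const (hm : 0 < m) (B : ℝ) :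
    1 / Real.sqrt m * ∑ _i : Fin m, B / Real.sqrt m = B := by
  have h : (0 : ℝ) < m := by exact_mod_cast hm
  rw [Finset.sum_const, Finset.card_univ, Fintype.card_fin, nsmul_eq_mul]
  have hs0 : Real.sqrt m ≠ 0 := (Real.sqrt_pos.2 h).ne'
  field_simp
  rw [Real.sq_sqrt h.le]

/-- ReLU is 1-Lipschitz, and `m` rows each contributing `B/√m` add up to `B` after the factor
`1/√m`. -/
theorem abs_net_sub_net_le (hm : 0 < m) (hc : ∀ i, |c i| ≤ 1) (hx : ‖x‖ ≤ 1) {B : ℝ}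
    (hθ : ∀ i, ‖θ i - θ' i‖ ≤ B / Real.sqrt m) : |net c θ x - net c θ' x| ≤ B := by
  rw [net, net, ← mul_sub, ← Finset.sum_sub_distrib, abs_mul,
    abs_of_nonneg (by positivity : 0 ≤ 1 / Real.sqrt (m : ℝ))]
  refine le_trans ?_ (one_div_sqrt_mul_sum_const hm B).le
  refine mul_le_mul_of_nonneg_left ((Finset.abs_sum_le_sum_abs _ _).trans
    (Finset.sum_le_sum fun i _ => ?_)) (by positivity)
  rw [← mul_sub, abs_mul]
  calc |c i| * |max 0 (inner ℝ (θ i) x) - max 0 (inner ℝ (θ' i) x)|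
      ≤ 1 * |inner ℝ (θ i) x - inner ℝ (θ' i) x| := by
        refine mul_le_mul (hc i) ?_ (abs_nonneg _) zero_le_one
        rw [max_comm 0, max_comm 0]
        exact abs_max_sub_max_le_abs _ _ _
    _ ≤ ‖θ i - θ' i‖ * ‖x‖ := by
        rw [one_mul, ← inner_sub_left]
        exact abs_real_inner_le_norm _ _
    _ ≤ B / Real.sqrt m := (mul_le_of_le_one_right (norm_nonneg _) hx).trans (hθ i)

/-- The two expressions differ only when `a` and `b` lie on opposite sides of zero; then both `|a|`
and `|b|` are at most `|a - b| ≤ τ`. -/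
theorem abs_max_sub_indicator_mul_le {a b τ : ℝ} (h : |a - b| ≤ τ) :
    |max 0 b - (if 0 ≤ a then 1 else 0) * b| ≤ if |a| ≤ τ then τ else 0 := by
  have hτ : 0 ≤ τ := (abs_nonneg _).trans h
  obtain ⟨h1, h2⟩ := abs_le.1 h
  by_cases ha : 0 ≤ a
  · rw [if_pos ha, one_mul]
    rcases le_total 0 b with hb | hb
    · rw [max_eq_right hb, sub_self, abs_zero]
      split_ifs <;> linarith
    · rw [max_eq_left hb, if_pos (by rw [abs_of_nonneg ha]; linarith), zero_sub, abs_neg,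
        abs_of_nonpos hb]
      linarith
  · rw [if_neg ha, zero_mul, sub_zero]
    push Not at ha
    rcases le_total 0 b with hb | hb
    · rw [max_eq_right hb, if_pos (by rw [abs_of_neg ha]; linarith), abs_of_nonneg hb]
      linarith
    · rw [max_eq_left hb, abs_zero]
      split_ifs <;> linarith

/-- Only neurons whose activation can flip contribute, each at most `r/√m`, and the hypothesis `hρ`
bounds their number. For inputs shorter than 1 the flip condition is homogeneous in `x`, so it can
be tested at `x/‖x‖`. -/
theorem abs_net_sub_inner_netGrad_le (hc : ∀ i, |c i| ≤ 1) {r ρ : ℝ}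
    (hθ : ∀ i, ‖θ i - θ' i‖ ≤ r / Real.sqrt m) (hr : 0 ≤ r) (hρ0 : 0 ≤ ρ)
    (hρ : ∀ x : E d, ‖x‖ = 1 → r / (m : ℝ) * ∑ i : Fin m,
      (if |inner ℝ (θ' i) x| ≤ r / Real.sqrt m then (1 : ℝ) else 0) ≤ ρ)
    (hx : ‖x‖ ≤ 1) :
    |net c θ x - inner ℝ (netGrad c θ' x) θ| ≤ ρ := by
  rcases eq_or_ne x 0 with rfl | hx0
  · simpa [net, inner_netGrad] using hρ0
  have hxn : 0 < ‖x‖ := norm_pos_iff.2 hx0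
  have hxs : ‖(‖x‖⁻¹ : ℝ) • x‖ = 1 := by
    rw [norm_smul, norm_inv, norm_norm, inv_mul_cancel₀ hxn.ne']
  refine le_trans ?_ (hρ _ hxs)
  have key : ∀ i, |c i * max 0 (inner ℝ (θ i) x)
        - c i * ((if 0 ≤ inner ℝ (θ' i) x then 1 else 0) * inner ℝ (θ i) x)|
      ≤ r / Real.sqrt m *
        (if |inner ℝ (θ' i) ((‖x‖⁻¹ : ℝ) • x)| ≤ r / Real.sqrt m then (1 : ℝ) else 0) := by
    intro i
    rw [← mul_sub, abs_mul]
    refine (mul_le_of_le_one_left (abs_nonneg _) (hc i)).trans ?_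
    have hd : |inner ℝ (θ' i) x - inner ℝ (θ i) x| ≤ r / Real.sqrt m * ‖x‖ := by
      rw [← inner_sub_left]
      refine (abs_real_inner_le_norm _ _).trans (mul_le_mul_of_nonneg_right ?_ hxn.le)
      rw [norm_sub_rev]
      exact hθ i
    refine (abs_max_sub_indicator_mul_le hd).trans ?_
    have hiff : |inner ℝ (θ' i) ((‖x‖⁻¹ : ℝ) • x)| ≤ r / Real.sqrt m
        ↔ |inner ℝ (θ' i) x| ≤ r / Real.sqrt m * ‖x‖ := by
      rw [real_inner_smul_right, abs_mul, abs_inv, abs_norm, inv_mul_le_iff₀ hxn, mul_comm ‖x‖]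
    simp only [hiff]
    split_ifs
    · rw [mul_one]
      exact mul_le_of_le_one_right (by positivity) hx
    · simp
  rw [net, inner_netGrad, ← mul_sub, ← Finset.sum_sub_distrib, abs_mul,
    abs_of_nonneg (by positivity : 0 ≤ 1 / Real.sqrt (m : ℝ))]
  have hmm : r / (m : ℝ) = 1 / Real.sqrt m * (r / Real.sqrt m) := by
    rw [div_mul_div_comm, one_mul, Real.mul_self_sqrt (Nat.cast_nonneg m)]
  rw [hmm, mul_assoc, Finset.mul_sum]
  exact mul_le_mul_of_nonneg_left ((Finset.abs_sum_le_sum_abs _ _).trans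
    (Finset.sum_le_sum fun i _ => key i)) (by positivity)

end Network

/-! ### Symmetric initialization: bounded signs and a vanishing initial network -/

section Initialization

variable {k d : ℕ} (w : Init k d)

theorem Init.abs_c_le_one (i : Fin (k + k)) : |w.c i| ≤ 1 := by
  have h : ∀ j, |((w.1 j : ℤ) : ℝ)| ≤ 1 := fun j => by
    rcases Int.units_eq_one_or (w.1 j) with h | h <;> simp [h]
  refine Fin.addCases (fun j => ?_) (fun j => ?_) i
  · rw [Init.c, Fin.append_left]
    exact h j
  · rw [Init.c, Fin.append_right, abs_neg]
    exact h j

theorem Init.net_eq_zero (x : E d) : net w.c w.θ x = 0 := by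
  rw [net, Fin.sum_univ_add]
  simp only [Init.c, Init.θ, Fin.append_left, Fin.append_right, neg_mul, Finset.sum_neg_distrib,
    add_neg_cancel, mul_zero]

end Initialization

/-! ### Softmax policies and relative entropy -/

/-- **Hoeffding's lemma** for a finite probability vector. -/
theorem log_sum_mul_exp_le {A : Type*} [Fintype A] {p D : A → ℝ} (hp : ∀ a, 0 ≤ p a)
    (hp1 : ∑ a, p a = 1) {B : ℝ} (hD : ∀ a, |D a| ≤ B) :
    Real.log (∑ a, p a * Real.exp (D a)) ≤ ∑ a, p a * D a + B ^ 2 / 2 := by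
  let _ : MeasurableSpace A := ⊤
  let ν : Measure A := ∑ a, ENNReal.ofReal (p a) • Measure.dirac a
  have hν : IsProbabilityMeasure ν := ⟨by
    simp only [ν, Measure.coe_finsetSum, Finset.sum_apply, Measure.smul_apply, smul_eq_mul,
      measure_univ, mul_one]
    rw [← ENNReal.ofReal_sum_of_nonneg fun a _ => hp a, hp1, ENNReal.ofReal_one]⟩
  have hint : ∀ g : A → ℝ, ∫ a, g a ∂ν = ∑ a, p a * g a := fun g => by
    rw [integral_finsetSum_measure]
    · refine Finset.sum_congr rfl fun a _ => ?_
      rw [integral_smul_measure, integral_dirac, ENNReal.toReal_ofReal (hp a), smul_eq_mul]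
    · intro a _
      exact (integrable_dirac (by simp)).smul_measure ENNReal.ofReal_ne_top
  have h := (hasSubgaussianMGF_of_mem_Icc (μ := ν) (X := D) (a := -B) (b := B)
    Measurable.of_discrete.aemeasurable (ae_of_all _ fun a => abs_le.1 (hD a))).mgf_le 1
  have hA : Nonempty A := by
    by_contra hA
    rw [not_nonempty_iff] at hA
    simp at hp1
  have hB : 0 ≤ B := (abs_nonneg _).trans (hD hA.some)
  -- The variance proxy of a variable in `[-B, B]` is the squared half-length of the interval.
  have hc : (((‖B - -B‖₊ / 2) ^ 2 : NNReal) : ℝ) = B ^ 2 := by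
    push_cast
    rw [Real.norm_eq_abs, div_pow, sq_abs]
    ring
  rw [hc, mgf, hint, hint] at h
  have hfac : ∑ a, p a * Real.exp (1 * (D a - ∑ a, p a * D a))
      = Real.exp (-∑ a, p a * D a) * ∑ a, p a * Real.exp (D a) := by
    rw [Finset.mul_sum]
    refine Finset.sum_congr rfl fun a _ => ?_
    rw [one_mul, sub_eq_add_neg, Real.exp_add]
    ring
  rw [hfac, one_pow, mul_one] at h
  have hpos : 0 < ∑ a, p a * Real.exp (D a) := by
    obtain ⟨a, ha⟩ : ∃ a, 0 < p a := by
      by_contra hcon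
      push Not at hcon
      have : ∑ a, p a ≤ 0 := Finset.sum_nonpos fun a _ => hcon a
      linarith
    exact Finset.sum_pos' (fun a _ => mul_nonneg (hp a) (Real.exp_pos _).le)
      ⟨a, Finset.mem_univ a, mul_pos ha (Real.exp_pos _)⟩
  have h' := Real.log_le_log (mul_pos (Real.exp_pos _) hpos) h
  rw [Real.log_mul (Real.exp_pos _).ne' hpos.ne', Real.log_exp, Real.log_exp] at h'
  linarith

theorem Policy.kl_eq {S A : Type*} [MeasurableSpace S] [Fintype A] (π π' : Policy S A) (s : S)
    (h : ∀ a, 0 < π'.prob s a) :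
    π.kl π' s = -π.entropy s - ∑ a, π.prob s a * Real.log (π'.prob s a) := by
  rw [Policy.kl, Policy.entropy, neg_neg, ← Finset.sum_sub_distrib]
  refine Finset.sum_congr rfl fun a _ => ?_
  rcases (π.nonneg s a).eq_or_lt with h0 | h0
  · simp [← h0]
  · rw [Real.log_div h0.ne' (h a).ne']
    ring

section Softmax

variable {S A : Type*} [MeasurableSpace S] [Fintype A] [Nonempty A] [MeasurableSpace A]
variable {d m : ℕ} (M : MDP S A d) (c : Fin m → ℝ) (θ : Weights m d)

/-- Log-partition function `log ∑ₐ exp f(s,a;(c,θ))`. -/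
noncomputable def logPartition (s : S) : ℝ :=
  Real.log (∑ a, Real.exp (net c θ (M.feat s a)))

theorem sum_exp_net_pos (s : S) : 0 < ∑ a, Real.exp (net c θ (M.feat s a)) :=
  Finset.sum_pos (fun _ _ => Real.exp_pos _) Finset.univ_nonempty

theorem softmaxPolicy_prob_pos (s : S) (a : A) : 0 < (softmaxPolicy M c θ).prob s a :=
  div_pos (Real.exp_pos _) (sum_exp_net_pos M c θ s)

theorem log_softmaxPolicy_prob (s : S) (a : A) :
    Real.log ((softmaxPolicy M c θ).prob s a) = net c θ (M.feat s a) - logPartition M c θ s := by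
  change Real.log (Real.exp _ / _) = _
  rw [Real.log_div (Real.exp_pos _).ne' (sum_exp_net_pos M c θ s).ne', Real.log_exp]
  rfl

theorem kl_softmaxPolicy (π : Policy S A) (s : S) :
    π.kl (softmaxPolicy M c θ) s
      = -π.entropy s - π.avg (fun s a => net c θ (M.feat s a)) s + logPartition M c θ s := by
  rw [π.kl_eq _ s (softmaxPolicy_prob_pos M c θ s)]
  simp_rw [log_softmaxPolicy_prob, mul_sub]
  rw [Finset.sum_sub_distrib, ← Finset.sum_mul, π.sum_one, one_mul, Policy.avg]
  ring

theorem entropy_softmaxPolicy (s : S) :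
    (softmaxPolicy M c θ).entropy s
      = logPartition M c θ s
        - (softmaxPolicy M c θ).avg (fun s a => net c θ (M.feat s a)) s := by
  rw [Policy.entropy]
  simp_rw [log_softmaxPolicy_prob, mul_sub]
  rw [Finset.sum_sub_distrib, ← Finset.sum_mul, Policy.sum_one, one_mul, Policy.avg]
  ring

/-- The ratio of the two partition functions is the mean of `exp (f' - f)` under the softmax policy
of `θ`, to which Hoeffding's lemma applies. -/
theorem logPartition_sub_le (θ' : Weights m d) (s : S) {B : ℝ}
    (hB : ∀ a, |net c θ' (M.feat s a) - net c θ (M.feat s a)| ≤ B) :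
    logPartition M c θ' s - logPartition M c θ s
      ≤ (softmaxPolicy M c θ).avg
        (fun s a => net c θ' (M.feat s a) - net c θ (M.feat s a)) s + B ^ 2 / 2 := by
  have h := log_sum_mul_exp_le (p := (softmaxPolicy M c θ).prob s) ((softmaxPolicy M c θ).nonneg s)
    ((softmaxPolicy M c θ).sum_one s) hB
  have e : ∑ a, (softmaxPolicy M c θ).prob s a
        * Real.exp (net c θ' (M.feat s a) - net c θ (M.feat s a))
      = (∑ a, Real.exp (net c θ' (M.feat s a))) / ∑ a, Real.exp (net c θ (M.feat s a)) := by
    rw [Finset.sum_div]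
    refine Finset.sum_congr rfl fun a _ => ?_
    rw [Real.exp_sub]
    change Real.exp _ / _ * _ = _
    have := (Real.exp_pos (net c θ (M.feat s a))).ne'
    field_simp
  rw [e, Real.log_div (sum_exp_net_pos M c θ' s).ne' (sum_exp_net_pos M c θ s).ne'] at h
  exact h

theorem bddMeas_net_feat (a : A) : BddMeas fun s => net c θ (M.feat s a) := by
  have hf := M.feat_meas a
  refine (BddMeas.sum (S := S) Finset.univ fun i => BddMeas.const_mul (v := fun s =>
    max 0 (inner ℝ (θ i) (M.feat s a))) ⟨by fun_prop, ‖θ i‖, fun s => ?_⟩ (c i)).const_mul _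
  rw [abs_of_nonneg (le_max_left _ _)]
  exact max_le (norm_nonneg _) ((real_inner_le_norm _ _).trans
    (mul_le_of_le_one_right (norm_nonneg _) (M.feat_norm s a)))

theorem bddMeas_inner_netGrad_feat (v : Weights m d) (a : A) :
    BddMeas fun s => inner ℝ (netGrad c θ (M.feat s a)) v := by
  have hf := M.feat_meas a
  simp_rw [inner_netGrad]
  refine (BddMeas.sum (S := S) Finset.univ fun i => BddMeas.const_mul (v := fun s =>
    (if 0 ≤ inner ℝ (θ i) (M.feat s a) then (1 : ℝ) else 0) * inner ℝ (v i) (M.feat s a))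
      ⟨?_, ‖v i‖, fun s => ?_⟩ (c i)).const_mul _
  · refine Measurable.mul (Measurable.ite (measurableSet_le measurable_const (by fun_prop))
      measurable_const measurable_const) (by fun_prop)
  · have : |inner ℝ (v i) (M.feat s a)| ≤ ‖v i‖ := (abs_real_inner_le_norm _ _).trans
      (mul_le_of_le_one_right (norm_nonneg _) (M.feat_norm s a))
    dsimp only
    split_ifs
    · simpa using this
    · simp

theorem bddMeas_logPartition : BddMeas (logPartition M c θ) := by
  have hb : ∀ a, BddMeas fun s => net c θ (M.feat s a) := bddMeas_net_feat M c θ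
  refine ⟨(Finset.measurable_sum _ fun a _ => (hb a).1.exp).log, ?_⟩
  choose C hC using fun a => (hb a).2
  refine ⟨Real.log (Fintype.card A) + ∑ a, C a, fun s => ?_⟩
  have hC0 : ∀ a, 0 ≤ C a := fun a => (abs_nonneg _).trans (hC a s)
  have hle : ∀ a, C a ≤ ∑ a, C a := fun a =>
    Finset.single_le_sum (fun a _ => hC0 a) (Finset.mem_univ a)
  have hcard : (1 : ℝ) ≤ Fintype.card A := by exact_mod_cast Fintype.card_pos
  have hlog : 0 ≤ Real.log (Fintype.card A) := Real.log_nonneg hcard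
  rw [abs_le]
  constructor
  · obtain ⟨a⟩ := ‹Nonempty A›
    have h1 : Real.exp (-∑ a, C a) ≤ ∑ a, Real.exp (net c θ (M.feat s a)) := by
      refine le_trans ?_ (Finset.single_le_sum (fun a _ => (Real.exp_pos _).le)
        (Finset.mem_univ a))
      exact Real.exp_le_exp.2 (by have := (abs_le.1 (hC a s)).1; have := hle a; linarith)
    have h2 := Real.log_le_log (Real.exp_pos _) h1
    rw [Real.log_exp] at h2
    unfold logPartition
    linarith
  · have h1 : ∑ a, Real.exp (net c θ (M.feat s a))
        ≤ (Fintype.card A : ℝ) * Real.exp (∑ a, C a) := by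
      refine (Finset.sum_le_card_nsmul _ _ (Real.exp (∑ a, C a)) fun a _ => ?_).trans_eq ?_
      · exact Real.exp_le_exp.2 (by have := (abs_le.1 (hC a s)).2; have := hle a; linarith)
      · rw [nsmul_eq_mul, Finset.card_univ]
    have h2 := Real.log_le_log (sum_exp_net_pos M c θ s) h1
    rw [Real.log_mul (by positivity) (Real.exp_pos _).ne', Real.log_exp] at h2
    exact h2

theorem bddMeas_kl_softmaxPolicy (π : Policy S A) : BddMeas (π.kl (softmaxPolicy M c θ)) := by
  have : π.kl (softmaxPolicy M c θ) = fun s =>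
      -π.entropy s - π.avg (fun s a => net c θ (M.feat s a)) s + logPartition M c θ s :=
    funext fun s => kl_softmaxPolicy M c θ π s
  rw [this]
  exact (π.bddMeas_entropy.neg.sub (π.bddMeas_avg (bddMeas_net_feat M c θ))).add
    (bddMeas_logPartition M c θ)

end Softmax

/-! ### Bounds on the actor iterates -/

section Algorithm

/-- Compactness guarantees a nearest point, so the choice made in `proj` does land in the set. -/
theorem isCompact_rowBall {m d : ℕ} (v : Weights m d) (R : ℝ) : IsCompact (rowBall v R) := by
  have h : rowBall v R = WithLp.ofLp ⁻¹'
      (Set.univ.pi fun i => Metric.closedBall (v i) (R / Real.sqrt m)) := by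
    ext y
    simp [rowBall, dist_eq_norm, norm_sub_rev]
  rw [h]
  exact (PiLp.homeomorph 2 fun _ : Fin m => E d).isClosedEmbedding.isCompact_preimage
    (isCompact_univ_pi fun i => isCompact_closedBall _ _)

variable {S A : Type*} [MeasurableSpace S] [Fintype A] [Nonempty A] [MeasurableSpace A]
variable {d k k' : ℕ} (M : MDP S A d) (p : Params) (w : Init k d) (ζ : Realization S A k' d)

theorem norm_sgdIterate_apply_le (hR : 0 ≤ p.R) (θ : Weights (k + k) d) (t n : ℕ)
    (i : Fin (k + k)) :
    ‖sgdIterate M p w ζ θ t n i‖ ≤ p.R / Real.sqrt ((k + k : ℕ) : ℝ) := by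
  cases n with
  | zero =>
    change ‖(0 : E d)‖ ≤ _
    rw [norm_zero]
    positivity
  | succ n =>
    have hne : (rowBall (0 : Weights (k + k) d) p.R).Nonempty := ⟨0, fun i => by
      simp only [PiLp.zero_apply, sub_zero, norm_zero]
      positivity⟩
    have h : ∀ x, ‖proj (rowBall (0 : Weights (k + k) d) p.R) x i‖
        ≤ p.R / Real.sqrt ((k + k : ℕ) : ℝ) := fun x => by
      have h := (proj_spec (isCompact_rowBall (0 : Weights (k + k) d) p.R) hne x).1 i
      rwa [PiLp.zero_apply, zero_sub, norm_neg] at h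
    exact h _

theorem norm_sgdAverage_apply_le (hR : 0 ≤ p.R) (θ : Weights (k + k) d) (t : ℕ)
    (i : Fin (k + k)) :
    ‖sgdAverage M p w ζ θ t i‖ ≤ p.R / Real.sqrt ((k + k : ℕ) : ℝ) := by
  have hN0 : 0 ≤ p.R / Real.sqrt ((k + k : ℕ) : ℝ) := by positivity
  have e : sgdAverage M p w ζ θ t i
      = (p.N : ℝ)⁻¹ • ∑ n ∈ Finset.Icc 1 p.N, sgdIterate M p w ζ θ t n i := by
    rw [sgdAverage, PiLp.smul_apply, WithLp.ofLp_sum, Finset.sum_apply]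
  rw [e, norm_smul, norm_inv, Real.norm_natCast]
  have h : ‖∑ n ∈ Finset.Icc 1 p.N, sgdIterate M p w ζ θ t n i‖
      ≤ p.N * (p.R / Real.sqrt ((k + k : ℕ) : ℝ)) := by
    refine (norm_sum_le_of_le _ fun n _ => norm_sgdIterate_apply_le M p w ζ hR θ t n i).trans_eq ?_
    rw [Finset.sum_const, Nat.card_Icc, nsmul_eq_mul, Nat.add_sub_cancel]
  refine (mul_le_mul_of_nonneg_left h (by positivity)).trans ?_
  rw [← mul_assoc]
  -- Also correct for `p.N = 0`, where the inverse is 0 and the average is 0.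
  exact mul_le_of_le_one_left hN0 inv_mul_le_one

theorem actorWeights_succ_sub (t : ℕ) :
    actorWeights M p w ζ (t + 1) - w.θ
      = (1 - p.η t * p.lam) • (actorWeights M p w ζ t - w.θ) + p.η t • direction M p w ζ t := by
  change actorWeights M p w ζ t + p.η t • direction M p w ζ t
    - (p.η t * p.lam) • (actorWeights M p w ζ t - w.θ) - w.θ = _
  module

theorem norm_actorWeights_sub_apply_le (hR : 0 ≤ p.R) (hlam : 0 < p.lam)
    (hη_pos : ∀ t, 0 < p.η t) (hη_le : ∀ t, p.η t ≤ 1 / p.lam) (t : ℕ) (i : Fin (k + k)) :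
    ‖actorWeights M p w ζ t i - w.θ i‖ ≤ p.R / p.lam / Real.sqrt ((k + k : ℕ) : ℝ) := by
  induction t with
  | zero =>
    change ‖w.θ i - w.θ i‖ ≤ _
    rw [sub_self, norm_zero]
    positivity
  | succ t ih =>
    have h := congrArg (fun v : Weights (k + k) d => v i) (actorWeights_succ_sub M p w ζ t)
    simp only [PiLp.sub_apply, PiLp.add_apply, PiLp.smul_apply] at h
    have hηl : p.η t * p.lam ≤ 1 := by
      have := hη_le t
      rwa [le_div_iff₀ hlam] at this
    have hu := norm_sgdAverage_apply_le M p w ζ hR (actorWeights M p w ζ t) t i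
    rw [h]
    refine (norm_add_le _ _).trans ?_
    rw [norm_smul, norm_smul, Real.norm_of_nonneg (by linarith), Real.norm_of_nonneg (hη_pos t).le]
    -- The step is a convex combination with weights `1 - ηλ` and `ηλ` of the old displacement and
    -- `u_t/λ`, so the radius `R/λ` reproduces itself.
    have e : p.R / p.lam / Real.sqrt ((k + k : ℕ) : ℝ)
        = (1 - p.η t * p.lam) * (p.R / p.lam / Real.sqrt ((k + k : ℕ) : ℝ))
          + p.η t * (p.R / Real.sqrt ((k + k : ℕ) : ℝ)) := by
      have := hlam.ne'
      field_simp
      ring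
    rw [e]
    exact add_le_add (mul_le_mul_of_nonneg_left ih (by linarith))
      (mul_le_mul_of_nonneg_left hu (hη_pos t).le)

theorem norm_actorWeights_succ_sub_apply_le (hR : 0 ≤ p.R) (hlam : 0 < p.lam)
    (hη_pos : ∀ t, 0 < p.η t) (hη_le : ∀ t, p.η t ≤ 1 / p.lam) (t : ℕ) (i : Fin (k + k)) :
    ‖actorWeights M p w ζ (t + 1) i - actorWeights M p w ζ t i‖
      ≤ 2 * p.η t * p.R / Real.sqrt ((k + k : ℕ) : ℝ) := by
  have h : actorWeights M p w ζ (t + 1) i - actorWeights M p w ζ t i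
      = p.η t • direction M p w ζ t i
        - (p.η t * p.lam) • (actorWeights M p w ζ t i - w.θ i) := by
    have h := congrArg (fun v : Weights (k + k) d => v i) (actorWeights_succ_sub M p w ζ t)
    simp only [PiLp.sub_apply, PiLp.add_apply, PiLp.smul_apply] at h
    rw [← sub_sub_sub_cancel_right _ _ (w.θ i), h]
    module
  have hu := norm_sgdAverage_apply_le M p w ζ hR (actorWeights M p w ζ t) t i
  have ha := norm_actorWeights_sub_apply_le M p w ζ hR hlam hη_pos hη_le t i
  rw [h]
  refine (norm_sub_le _ _).trans ?_
  rw [norm_smul, norm_smul, Real.norm_of_nonneg (mul_pos (hη_pos t) hlam).le,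
    Real.norm_of_nonneg (hη_pos t).le]
  -- Direction and decay each contribute `ηR/√m`: in the decay term the factor `λ` cancels the
  -- radius `R/λ`.
  have e : 2 * p.η t * p.R / Real.sqrt ((k + k : ℕ) : ℝ)
      = p.η t * (p.R / Real.sqrt ((k + k : ℕ) : ℝ))
        + p.η t * p.lam * (p.R / p.lam / Real.sqrt ((k + k : ℕ) : ℝ)) := by
    have := hlam.ne'
    field_simp
    ring
  rw [e]
  exact add_le_add (mul_le_mul_of_nonneg_left hu (hη_pos t).le)
    (mul_le_mul_of_nonneg_left ha (mul_pos (hη_pos t) hlam).le)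

end Algorithm

/-! ### Lyapunov drift -/

section Drift

variable {S A : Type*} [MeasurableSpace S] [Fintype A] [Nonempty A] [MeasurableSpace A]
variable {d k k' : ℕ} (M : MDP S A d) (p : Params) (w : Init k d) (ζ : Realization S A k' d)

theorem Policy.avg_sub (π : Policy S A) (g h : S → A → ℝ) (s : S) :
    π.avg (fun s a => g s a - h s a) s = π.avg g s - π.avg h s := by
  simp only [Policy.avg, ← Finset.sum_sub_distrib]
  exact Finset.sum_congr rfl fun a _ => by ring

/-- The weight recursion is exactly linear, so the only errors are the linearization errors at times
`t + 1` and `t`, the latter weighted by `1 - ηλ ≤ 1`. -/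
theorem abs_net_actorWeights_sub_le (hR : 0 ≤ p.R) (hlam : 0 < p.lam)
    (hη_pos : ∀ t, 0 < p.η t) (hη_le : ∀ t, p.η t ≤ 1 / p.lam) {ρ : ℝ} (hρ0 : 0 ≤ ρ)
    (hρ : ∀ x : E d, ‖x‖ = 1 → p.R / p.lam / ((k + k : ℕ) : ℝ) * ∑ i : Fin (k + k),
      (if |inner ℝ (w.θ i) x| ≤ p.R / p.lam / Real.sqrt ((k + k : ℕ) : ℝ) then (1 : ℝ) else 0) ≤ ρ)
    (t : ℕ) {x : E d} (hx : ‖x‖ ≤ 1) :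
    |net w.c (actorWeights M p w ζ (t + 1)) x
      - ((1 - p.η t * p.lam) * net w.c (actorWeights M p w ζ t) x
        + p.η t * inner ℝ (netGrad w.c w.θ x) (direction M p w ζ t))| ≤ 2 * ρ := by
  have hr : 0 ≤ p.R / p.lam := by positivity
  have hηl : p.η t * p.lam ≤ 1 := by
    have := hη_le t
    rwa [le_div_iff₀ hlam] at this
  have hηl0 : 0 ≤ p.η t * p.lam := (mul_pos (hη_pos t) hlam).le
  have h : ∀ t, |net w.c (actorWeights M p w ζ t) x
      - inner ℝ (netGrad w.c w.θ x) (actorWeights M p w ζ t)| ≤ ρ := fun t =>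
    abs_net_sub_inner_netGrad_le w.abs_c_le_one
      (norm_actorWeights_sub_apply_le M p w ζ hR hlam hη_pos hη_le t) hr hρ0 hρ hx
  have h0 : inner ℝ (netGrad w.c w.θ x) w.θ = 0 := by
    rw [inner_netGrad_self, w.net_eq_zero]
  have e := congrArg (fun v => inner ℝ (netGrad w.c w.θ x) v) (actorWeights_succ_sub M p w ζ t)
  simp only [inner_sub_right, inner_add_right, real_inner_smul_right, h0, sub_zero] at e
  have h1 := abs_le.1 (h (t + 1))
  have h2 := abs_le.1 (h t)
  rw [e] at h1
  rw [abs_le]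
  constructor <;> nlinarith

/-- State-wise drift of the relative entropy along one actor update. -/
theorem kl_policyAt_succ_sub_le (hk : 0 < k) (hR : 0 ≤ p.R) (hlam : 0 < p.lam)
    (hη_pos : ∀ t, 0 < p.η t) (hη_le : ∀ t, p.η t ≤ 1 / p.lam) {ρ : ℝ} (hρ0 : 0 ≤ ρ)
    (hρ : ∀ x : E d, ‖x‖ = 1 → p.R / p.lam / ((k + k : ℕ) : ℝ) * ∑ i : Fin (k + k),
      (if |inner ℝ (w.θ i) x| ≤ p.R / p.lam / Real.sqrt ((k + k : ℕ) : ℝ) then (1 : ℝ) else 0) ≤ ρ)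
    [MeasurableSingletonClass A] (π : Policy S A) (t : ℕ) (s : S) :
    π.kl (policyAt M p w ζ (t + 1)) s - π.kl (policyAt M p w ζ t) s
      ≤ - (p.η t * p.lam) * π.kl (policyAt M p w ζ t) s
        - p.η t * (π.avg (M.Q p.lam (policyAt M p w ζ t)) s + p.lam * π.entropy s
          - M.Vreg p.lam (policyAt M p w ζ t) s)
        + p.η t * (policyAt M p w ζ t).avg (fitError M p w ζ t) s
        - p.η t * π.avg (fitError M p w ζ t) s
        + (2 * p.η t ^ 2 * p.R ^ 2 + 4 * ρ) := by
  set f : S → A → ℝ := fun s a => net w.c (actorWeights M p w ζ t) (M.feat s a) with hf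
  set f' : S → A → ℝ := fun s a => net w.c (actorWeights M p w ζ (t + 1)) (M.feat s a) with hf'
  set h : S → A → ℝ := fun s a =>
    inner ℝ (netGrad w.c w.θ (M.feat s a)) (direction M p w ζ t) with hh
  set e : S → A → ℝ := fun s a =>
    f' s a - ((1 - p.η t * p.lam) * f s a + p.η t * h s a) with he
  have heb : ∀ a, |e s a| ≤ 2 * ρ := fun a =>
    abs_net_actorWeights_sub_le M p w ζ hR hlam hη_pos hη_le hρ0 hρ t (M.feat_norm s a)
  have hD : ∀ a, |f' s a - f s a| ≤ 2 * p.η t * p.R := fun a =>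
    abs_net_sub_net_le (by omega) w.abs_c_le_one (M.feat_norm s a)
      (norm_actorWeights_succ_sub_apply_le M p w ζ hR hlam hη_pos hη_le t)
  have hZ : logPartition M w.c (actorWeights M p w ζ (t + 1)) s
        - logPartition M w.c (actorWeights M p w ζ t) s
      ≤ (policyAt M p w ζ t).avg (fun s a => f' s a - f s a) s + (2 * p.η t * p.R) ^ 2 / 2 :=
    logPartition_sub_le M w.c (actorWeights M p w ζ t) (actorWeights M p w ζ (t + 1)) s hD
  have k1 : π.kl (policyAt M p w ζ (t + 1)) s
      = -π.entropy s - π.avg f' s + logPartition M w.c (actorWeights M p w ζ (t + 1)) s :=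
    kl_softmaxPolicy M w.c (actorWeights M p w ζ (t + 1)) π s
  have k0 : π.kl (policyAt M p w ζ t) s
      = -π.entropy s - π.avg f s + logPartition M w.c (actorWeights M p w ζ t) s :=
    kl_softmaxPolicy M w.c (actorWeights M p w ζ t) π s
  have hH : (policyAt M p w ζ t).entropy s
      = logPartition M w.c (actorWeights M p w ζ t) s - (policyAt M p w ζ t).avg f s :=
    entropy_softmaxPolicy M w.c (actorWeights M p w ζ t) s
  have hV := M.Vreg_eq_avg_Q (policyAt M p w ζ t) p.lam s
  have havg : ∀ π : Policy S A, π.avg f' s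
      = (1 - p.η t * p.lam) * π.avg f s + p.η t * π.avg h s + π.avg e s := by
    intro π
    simp only [Policy.avg, he, Finset.mul_sum, ← Finset.sum_add_distrib]
    exact Finset.sum_congr rfl fun a _ => by ring
  have hfit : ∀ π : Policy S A, π.avg (fitError M p w ζ t) s
      = π.avg h s - π.avg (M.Q p.lam (policyAt M p w ζ t)) s := fun π =>
    π.avg_sub h (M.Q p.lam (policyAt M p w ζ t)) s
  rw [Policy.avg_sub] at hZ
  have e1 := abs_le.1 (π.abs_avg_le heb)
  have e2 := abs_le.1 ((policyAt M p w ζ t).abs_avg_le heb)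
  -- The log-partition terms cancel through `E_π f - E_{π_t} f = H(π_t) - H(π) - KL`, where `KL` is
  -- the divergence of `π_t` from `π`. The averages of `e` under the two policies cost `2ρ` each,
  -- which gives `4ρ`.
  rw [k1, k0, hfit, hfit, hV, hH]
  rw [havg] at hZ ⊢
  nlinarith [e1.1, e2.2, hZ]

theorem bddMeas_fitError [MeasurableSingletonClass A] (t : ℕ) (a : A) :
    BddMeas fun s => fitError M p w ζ t s a :=
  (bddMeas_inner_netGrad_feat M w.c w.θ (direction M p w ζ t) a).sub
    (M.bddMeas_Q (policyAt M p w ζ t) p.lam a)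

theorem potential_policyAt_succ_sub_le [MeasurableSingletonClass A] (hk : 0 < k) (hR : 0 ≤ p.R)
    (hlam : 0 < p.lam) (hη_pos : ∀ t, 0 < p.η t) (hη_le : ∀ t, p.η t ≤ 1 / p.lam)
    {ρ : ℝ} (hρ0 : 0 ≤ ρ)
    (hρ : ∀ x : E d, ‖x‖ = 1 → p.R / p.lam / ((k + k : ℕ) : ℝ) * ∑ i : Fin (k + k),
      (if |inner ℝ (w.θ i) x| ≤ p.R / p.lam / Real.sqrt ((k + k : ℕ) : ℝ) then (1 : ℝ) else 0) ≤ ρ)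
    (μ : Measure S) [IsProbabilityMeasure μ] (π : Policy S A) (t : ℕ) :
    M.potential μ π (policyAt M p w ζ (t + 1)) - M.potential μ π (policyAt M p w ζ t)
      ≤ - (p.η t * p.lam) * M.potential μ π (policyAt M p w ζ t)
        - p.η t * ((1 - M.γ) *
          (M.Vmean p.lam μ π - M.Vmean p.lam μ (policyAt M p w ζ t)))
        + p.η t * expect (M.visit μ π) (policyAt M p w ζ t) (fitError M p w ζ t)
        - p.η t * expect (M.visit μ π) π (fitError M p w ζ t)
        + (2 * p.η t ^ 2 * p.R ^ 2 + 4 * ρ) := by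
  have b1 : BddMeas (π.kl (policyAt M p w ζ (t + 1))) :=
    bddMeas_kl_softmaxPolicy M w.c (actorWeights M p w ζ (t + 1)) π
  have b0 : BddMeas (π.kl (policyAt M p w ζ t)) :=
    bddMeas_kl_softmaxPolicy M w.c (actorWeights M p w ζ t) π
  have bA : BddMeas fun s => π.avg (M.Q p.lam (policyAt M p w ζ t)) s + p.lam * π.entropy s
      - M.Vreg p.lam (policyAt M p w ζ t) s :=
    ((π.bddMeas_avg (M.bddMeas_Q _ _)).add (π.bddMeas_entropy.const_mul _)).sub
      (M.bddMeas_Vreg _ _)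
  have bF := (policyAt M p w ζ t).bddMeas_avg (bddMeas_fitError M p w ζ t)
  have bF' := π.bddMeas_avg (bddMeas_fitError M p w ζ t)
  rw [MDP.potential, MDP.potential, ← M.performance_difference]
  set ν := M.visit μ π
  change _ ≤ _ + p.η t * (∫ s, (policyAt M p w ζ t).avg (fitError M p w ζ t) s ∂ν)
    - p.η t * (∫ s, π.avg (fitError M p w ζ t) s ∂ν) + _
  rw [← integral_sub (b1.integrable ν) (b0.integrable ν)]
  have i1 := b0.const_mul (-(p.η t * p.lam))
  have i2 := bA.const_mul (p.η t)
  have i3 := bF.const_mul (p.η t)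
  have i4 := bF'.const_mul (p.η t)
  have hle := integral_mono (μ := ν) ((b1.sub b0).integrable ν)
    (((((i1.sub i2).add i3).sub i4).add (BddMeas.const _)).integrable ν)
    fun s => kl_policyAt_succ_sub_le M p w ζ hk hR hlam hη_pos hη_le hρ0 hρ π t s
  rwa [integral_add ((((i1.sub i2).add i3).sub i4).integrable ν) ((BddMeas.const _).integrable ν),
    integral_sub (((i1.sub i2).add i3).integrable ν) (i4.integrable ν),
    integral_add ((i1.sub i2).integrable ν) (i3.integrable ν),
    integral_sub (i1.integrable ν) (i2.integrable ν), integral_const_mul, integral_const_mul,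
    integral_const_mul, integral_const_mul, integral_const, probReal_univ, one_smul] at hle

end Drift

/-! ### Uniform anti-concentration of the Gaussian initialization -/

section Gaussian

variable {d : ℕ}

theorem stdGaussian_map_inner (x : E d) (hx : ‖x‖ = 1) :
    (stdGaussian (E d)).map (fun g => inner ℝ x g) = gaussianReal 0 1 := by
  have h := IsGaussian.map_eq_gaussianReal (μ := stdGaussian (E d)) (innerSL ℝ x)
  rw [integral_strongDual_stdGaussian, variance_dual_stdGaussian, innerSL_apply_norm, hx] at h
  simpa using h

/-- The density is at most `1/√(2π) ≤ 1/2` and the interval has length `2r`. -/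
theorem gaussianReal_Icc_le {r : ℝ} (hr : 0 ≤ r) :
    (gaussianReal 0 1).real (Set.Icc (-r) r) ≤ r := by
  have hpdf : ∀ x, gaussianPDFReal 0 1 x ≤ 1 / 2 := fun x => by
    rw [gaussianPDFReal_def]
    have h2 : (2 : ℝ) ≤ Real.sqrt (2 * Real.pi * (1 : NNReal)) := by
      refine Real.le_sqrt_of_sq_le ?_
      have := Real.pi_gt_three
      push_cast
      linarith
    have h3 : Real.exp (-(x - 0) ^ 2 / (2 * ((1 : NNReal) : ℝ))) ≤ 1 :=
      Real.exp_le_one_iff.2 (by push_cast; nlinarith [sq_nonneg (x - 0)])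
    calc _ ≤ (2 : ℝ)⁻¹ * 1 := mul_le_mul (inv_anti₀ two_pos h2) h3 (Real.exp_pos _).le
          (by norm_num)
      _ = 1 / 2 := by norm_num
  have h : gaussianReal 0 1 (Set.Icc (-r) r) ≤ ENNReal.ofReal r := by
    rw [gaussianReal_apply _ one_ne_zero]
    calc ∫⁻ x in Set.Icc (-r) r, gaussianPDF 0 1 x
        ≤ ∫⁻ _x in Set.Icc (-r) r, ENNReal.ofReal (1 / 2) :=
          lintegral_mono fun x => ENNReal.ofReal_le_ofReal (hpdf x)
      _ = ENNReal.ofReal r := by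
          rw [setLIntegral_const, Real.volume_Icc, ← ENNReal.ofReal_mul (by norm_num)]
          congr 1
          ring
  exact ENNReal.toReal_le_of_le_ofReal hr h

theorem stdGaussian_abs_inner_le {x : E d} (hx : ‖x‖ = 1) {r : ℝ} (hr : 0 ≤ r) :
    (stdGaussian (E d)).real {g | |inner ℝ x g| ≤ r} ≤ r := by
  have h := gaussianReal_Icc_le hr
  rw [← stdGaussian_map_inner x hx, map_measureReal_apply (by fun_prop) measurableSet_Icc] at h
  convert h using 2
  ext g
  simp [abs_le]

theorem integrable_norm_sq_stdGaussian : Integrable (fun g : E d => ‖g‖ ^ 2) (stdGaussian (E d)) :=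
  (IsGaussian.memLp_two_id (μ := stdGaussian (E d))).integrable_norm_pow two_ne_zero

theorem integral_norm_sq_stdGaussian : ∫ g : E d, ‖g‖ ^ 2 ∂(stdGaussian (E d)) = d := by
  have hcoord : ∀ i : Fin d, ∫ g : E d, (inner ℝ (EuclideanSpace.single i (1 : ℝ)) g) ^ 2
      ∂(stdGaussian (E d)) = 1 := by
    intro i
    have hn : ‖(EuclideanSpace.single i (1 : ℝ) : E d)‖ = 1 := by simp
    have h := stdGaussian_map_inner (EuclideanSpace.single i (1 : ℝ) : E d) hn
    have h2 : ∫ y, y ^ 2 ∂(gaussianReal 0 1) = 1 := by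
      have := variance_of_integral_eq_zero (μ := gaussianReal 0 1) (X := fun x => x)
        (by fun_prop) integral_id_gaussianReal
      rw [variance_fun_id_gaussianReal] at this
      simpa using this.symm
    rw [← h, integral_map (by fun_prop) (by fun_prop)] at h2
    exact h2
  have hint : ∀ i : Fin d, Integrable (fun g : E d =>
      (inner ℝ (EuclideanSpace.single i (1 : ℝ)) g) ^ 2) (stdGaussian (E d)) := by
    intro i
    refine integrable_norm_sq_stdGaussian.mono' (by fun_prop) (ae_of_all _ fun g => ?_)
    rw [Real.norm_eq_abs, abs_pow]
    refine pow_le_pow_left₀ (abs_nonneg _) ((abs_real_inner_le_norm _ _).trans ?_) 2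
    simp
  calc ∫ g : E d, ‖g‖ ^ 2 ∂(stdGaussian (E d))
      = ∫ g : E d, ∑ i, (inner ℝ (EuclideanSpace.single i (1 : ℝ)) g) ^ 2
        ∂(stdGaussian (E d)) := by
        congr 1
        funext g
        rw [EuclideanSpace.norm_sq_eq]
        refine Finset.sum_congr rfl fun i _ => ?_
        rw [EuclideanSpace.inner_single_left]
        simp
    _ = d := by
        rw [integral_finsetSum _ fun i _ => hint i]
        simp [hcoord]

/-- Markov's inequality for `‖g‖²`, whose mean is `d`. -/
theorem stdGaussian_norm_gt_le {s : ℝ} (hs : 0 < s) :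
    (stdGaussian (E d)).real {g | s < ‖g‖} ≤ d / s ^ 2 := by
  have h := mul_meas_ge_le_integral_of_nonneg (μ := stdGaussian (E d))
    (ae_of_all _ fun g : E d => sq_nonneg ‖g‖) integrable_norm_sq_stdGaussian (s ^ 2)
  rw [integral_norm_sq_stdGaussian] at h
  rw [le_div_iff₀ (by positivity), mul_comm]
  refine le_trans (mul_le_mul_of_nonneg_left (measureReal_mono fun g hg => ?_) (by positivity)) h
  exact pow_le_pow_left₀ hs.le (le_of_lt hg) 2

/-- A finite set of unit vectors approximating the unit sphere. -/
theorem exists_sphere_net (d : ℕ) {m : ℕ} (hm : 0 < m) :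
    ∃ T : Finset (E d), T.card ≤ (2 * m + 1) ^ d ∧ (∀ x ∈ T, ‖x‖ = 1) ∧
      ∀ x : E d, ‖x‖ = 1 → ∃ y ∈ T, ‖x - y‖ ≤ Real.sqrt d / m := by
  classical
  have hm' : (0 : ℝ) < m := by exact_mod_cast hm
  -- The sphere is cut into grid cells of side `1/m`. One representative per occupied cell is taken
  -- on the sphere itself, so that its inner product with a Gaussian row is standard normal.
  let q : E d → Fin d → ℤ := fun x i => ⌊x i * m⌋
  let B : Finset (Fin d → ℤ) := Fintype.piFinset fun _ => Finset.Icc (-(m : ℤ)) m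
  have hB : B.card = (2 * m + 1) ^ d := by
    simp only [B, Fintype.card_piFinset, Finset.prod_const, Finset.card_univ, Fintype.card_fin,
      Int.card_Icc]
    congr 1
    omega
  have hq : ∀ x : E d, ‖x‖ = 1 → q x ∈ B := by
    intro x hx
    rw [Fintype.mem_piFinset]
    intro i
    have hi : |x i| ≤ 1 := by
      have := PiLp.norm_apply_le x i
      rwa [hx, Real.norm_eq_abs] at this
    obtain ⟨h1, h2⟩ := abs_le.1 hi
    rw [Finset.mem_Icc]
    constructor
    · rw [Int.le_floor]
      push_cast
      nlinarith
    · have : ((⌊x i * m⌋ : ℤ) : ℝ) ≤ m := (Int.floor_le _).trans (by nlinarith)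
      exact_mod_cast this
  let Q := B.filter fun b => ∃ x : E d, ‖x‖ = 1 ∧ q x = b
  let rep : (Fin d → ℤ) → E d := fun b =>
    if h : ∃ x : E d, ‖x‖ = 1 ∧ q x = b then h.choose else 0
  have hrep : ∀ b ∈ Q, ‖rep b‖ = 1 ∧ q (rep b) = b := by
    intro b hb
    have h := (Finset.mem_filter.1 hb).2
    simp only [rep, dif_pos h]
    exact h.choose_spec
  refine ⟨Q.image rep, Finset.card_image_le.trans ((Finset.card_filter_le _ _).trans hB.le),
    fun x hx => ?_, fun x hx => ⟨rep (q x), ?_, ?_⟩⟩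
  · obtain ⟨b, hb, rfl⟩ := Finset.mem_image.1 hx
    exact (hrep b hb).1
  · exact Finset.mem_image_of_mem _ (Finset.mem_filter.2 ⟨hq x hx, x, hx, rfl⟩)
  · have hy := (hrep (q x) (Finset.mem_filter.2 ⟨hq x hx, x, hx, rfl⟩)).2
    set y := rep (q x)
    rw [EuclideanSpace.norm_eq]
    have hle : ∑ i, ‖(x - y) i‖ ^ 2 ≤ d * (1 / (m : ℝ)) ^ 2 := by
      refine (Finset.sum_le_card_nsmul _ _ ((1 / (m : ℝ)) ^ 2) fun i _ => ?_).trans_eq (by simp)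
      have hi : ⌊y i * m⌋ = ⌊x i * m⌋ := congrFun hy i
      have h := Int.abs_sub_lt_one_of_floor_eq_floor hi.symm
      rw [← sub_mul, abs_mul, abs_of_pos hm'] at h
      refine pow_le_pow_left₀ (norm_nonneg _) ?_ 2
      rw [Real.norm_eq_abs, le_div_iff₀ hm']
      exact h.le
    refine (Real.sqrt_le_sqrt hle).trans_eq ?_
    rw [Real.sqrt_mul (Nat.cast_nonneg d), Real.sqrt_sq (by positivity)]
    ring

/-- **Hoeffding's inequality** for the number of independent samples falling in a set. -/
theorem pi_count_ge_le {X : Type*} [MeasurableSpace X] (ν : Measure X) [IsProbabilityMeasure ν]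
    {k : ℕ} (hk : 0 < k) {U : Set X} (hU : MeasurableSet U) {τ : ℝ} (hτ : 0 ≤ τ) :
    (Measure.pi fun _ : Fin k => ν).real
        {g | (k : ℝ) * (ν.real U + τ) ≤ ∑ i, U.indicator (fun _ => (1 : ℝ)) (g i)}
      ≤ Real.exp (-(2 * k * τ ^ 2)) := by
  let P : Measure (Fin k → X) := Measure.pi fun _ : Fin k => ν
  let Z : X → ℝ := U.indicator fun _ => (1 : ℝ)
  have hZ : Measurable Z := measurable_const.indicator hU
  have hk' : (0 : ℝ) < k := by exact_mod_cast hk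
  have hZI : ∫ x, Z x ∂ν = ν.real U := by
    simp only [Z]
    rw [integral_indicator_const _ hU, smul_eq_mul, mul_one]
  have hind : iIndepFun (fun i (g : Fin k → X) => Z (g i) - ν.real U) P :=
    iIndepFun_pi (X := fun _ x => Z x - ν.real U) fun i => (hZ.sub_const _).aemeasurable
  have hsub : ∀ i ∈ (Finset.univ : Finset (Fin k)),
      -- A variable in `[0, 1]` has variance proxy `1/4`; the sum of `k` has `k/4`, whence the
      -- exponent `-(kτ)²/(2·k/4) = -2kτ²`.
      HasSubgaussianMGF (fun g : Fin k → X => Z (g i) - ν.real U) (1 / 4) P := by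
    intro i _
    have hmp : MeasurePreserving (fun g : Fin k → X => g i) P ν := measurePreserving_eval _ i
    have h := hasSubgaussianMGF_of_mem_Icc (μ := P) (X := fun g => Z (g i)) (a := 0) (b := 1)
      (hZ.comp (measurable_pi_apply i)).aemeasurable (ae_of_all _ fun g => by
        by_cases hg : g i ∈ U <;> simp [Z, hg])
    have hmean : ∫ g, Z (g i) ∂P = ν.real U := by
      rw [← hZI, ← hmp.map_eq, integral_map hmp.measurable.aemeasurable hZ.aestronglyMeasurable]
    rw [hmean] at h
    convert h using 1
    simp only [sub_zero, nnnorm_one]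
    norm_num
  have h := HasSubgaussianMGF.measure_sum_ge_le_of_iIndepFun hind hsub
    (mul_nonneg hk'.le hτ)
  have hset : {g : Fin k → X | (k : ℝ) * (ν.real U + τ) ≤ ∑ i, Z (g i)}
      = {g | (k : ℝ) * τ ≤ ∑ i, (Z (g i) - ν.real U)} := by
    ext g
    simp only [Set.mem_ofPred_eq, Finset.sum_sub_distrib, Finset.sum_const, Finset.card_univ,
      Fintype.card_fin, nsmul_eq_mul]
    constructor <;> intro h <;> linarith
  change P.real {g : Fin k → X | (k : ℝ) * (ν.real U + τ) ≤ ∑ i, Z (g i)} ≤ _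
  rw [hset]
  refine h.trans_eq ?_
  congr 1
  simp only [Finset.sum_const, Finset.card_univ, Fintype.card_fin, nsmul_eq_mul]
  push_cast
  field_simp
  ring

end Gaussian

/-! ### From a single direction to the whole sphere: net, union bound and the probability of the
initialization event -/

section UniformBound

variable {d : ℕ}

/-- Weight vectors that are nearly orthogonal to `y` or unusually long. -/
def badWeights (y : E d) (r s : ℝ) : Set (E d) := {g | |inner ℝ y g| ≤ r} ∪ {g | s < ‖g‖}

theorem measurableSet_badWeights (y : E d) (r s : ℝ) : MeasurableSet (badWeights y r s) :=
  (measurableSet_le (by fun_prop) measurable_const).union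
    (measurableSet_lt measurable_const (by fun_prop))

theorem stdGaussian_badWeights_le {y : E d} (hy : ‖y‖ = 1) {r s : ℝ} (hr : 0 ≤ r) (hs : 0 < s) :
    (stdGaussian (E d)).real (badWeights y r s) ≤ r + d / s ^ 2 :=
  (measureReal_union_le _ _).trans
    (add_le_add (stdGaussian_abs_inner_le hy hr) (stdGaussian_norm_gt_le hs))

/-- Moving from `x` to `y` changes the inner product by at most `sε` unless `g` is longer than `s`.
The dominating set depends on `y` alone, so one estimate per net point covers all nearby `x`. -/
theorem indicator_abs_inner_le {x y g : E d} {r ε s : ℝ} (hxy : ‖x - y‖ ≤ ε) :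
    (if |inner ℝ g x| ≤ r then (1 : ℝ) else 0)
      ≤ (badWeights y (r + s * ε) s).indicator (fun _ => (1 : ℝ)) g := by
  split_ifs with h
  · rw [Set.indicator_of_mem]
    by_cases hg : s < ‖g‖
    · exact Or.inr hg
    · refine Or.inl ?_
      push Not at hg
      have h1 : |inner ℝ y g - inner ℝ x g| ≤ s * ε := by
        rw [← inner_sub_left, mul_comm]
        refine (abs_real_inner_le_norm _ _).trans ?_
        rw [norm_sub_rev]
        exact mul_le_mul hxy hg (norm_nonneg _) ((norm_nonneg _).trans hxy)
      rw [real_inner_comm] at h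
      have h2 := abs_sub_abs_le_abs_sub (inner ℝ y g) (inner ℝ x g)
      change |inner ℝ y g| ≤ r + s * ε
      linarith
  · exact Set.indicator_nonneg (fun _ _ => zero_le_one) _

/-- Union bound over a net of cardinality at most `(2m+1)^d`. -/
theorem net_card_mul_exp_le {m : ℕ} (hm : 2 ≤ m) {δ : ℝ} (hδ : 0 < δ) (hδ1 : δ < 1) :
    (((2 * m + 1) ^ d : ℕ) : ℝ) * Real.exp (-(Real.sqrt (Real.log (1 / δ))
      + 2 * Real.sqrt (d * Real.log m)) ^ 2) ≤ δ := by
  have hm' : (2 : ℝ) ≤ m := by exact_mod_cast hm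
  have hlog : 0 ≤ Real.log m := Real.log_nonneg (by linarith)
  have hL : 0 ≤ Real.log (1 / δ) := Real.log_nonneg (by rw [le_div_iff₀ hδ]; linarith)
  have hcard : (((2 * m + 1) ^ d : ℕ) : ℝ) ≤ Real.exp (3 * (d * Real.log m)) := by
    -- The net has at most `m^(3d)` points, while the square in the exponent yields at least
    -- `log(1/δ) + 4 d log m`; this is where the factor 2 before the square root is needed.
    have h1 : (2 * m + 1 : ℝ) ≤ (m : ℝ) ^ 3 := by nlinarith [mul_self_nonneg ((m : ℝ) - 2)]
    have h2 : Real.exp (3 * (d * Real.log m)) = ((m : ℝ) ^ 3) ^ d := by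
      rw [← Real.exp_log (show (0 : ℝ) < ((m : ℝ) ^ 3) ^ d by positivity), Real.log_pow,
        Real.log_pow]
      congr 1
      push_cast
      ring
    rw [h2]
    push_cast
    exact pow_le_pow_left₀ (by positivity) h1 d
  have hexp : Real.exp (-(Real.sqrt (Real.log (1 / δ)) + 2 * Real.sqrt (d * Real.log m)) ^ 2)
      ≤ Real.exp (Real.log δ - 4 * (d * Real.log m)) := by
    rw [Real.exp_le_exp]
    have e1 := Real.sq_sqrt hL
    have e2 := Real.sq_sqrt (show 0 ≤ d * Real.log m by positivity)
    have e3 := mul_nonneg (Real.sqrt_nonneg (Real.log (1 / δ)))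
      (Real.sqrt_nonneg (d * Real.log m))
    have e4 : Real.log (1 / δ) = -Real.log δ := by rw [one_div, Real.log_inv]
    rw [e4] at e1 e3 ⊢
    nlinarith
  refine (mul_le_mul hcard hexp (Real.exp_pos _).le (Real.exp_pos _).le).trans ?_
  rw [← Real.exp_add]
  calc _ ≤ Real.exp (Real.log δ) := Real.exp_le_exp.2 (by
        have : 0 ≤ d * Real.log m := by positivity
        linarith)
    _ = δ := Real.exp_log hδ

theorem pi_stdGaussian_compl_le {k : ℕ} (hk : 0 < k) (hd : 0 < d) {R₀ δ : ℝ} (hR : 0 < R₀)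
    (hδ : 0 < δ) (hδ1 : δ < 1)
    (hbig : 16 * (R₀ + Real.sqrt (Real.log (1 / δ))
        + Real.sqrt (d * Real.log ((k + k : ℕ) : ℝ)))
      < Real.sqrt ((k + k : ℕ) : ℝ)) :
    (Measure.pi fun _ : Fin k => stdGaussian (E d)).real
      {g | ∀ x : E d, ‖x‖ = 1 →
        ∑ i, (if |inner ℝ (g i) x| ≤ R₀ / Real.sqrt ((k + k : ℕ) : ℝ) then (1 : ℝ) else 0)
          ≤ k * (16 / Real.sqrt ((k + k : ℕ) : ℝ) * (R₀ + Real.sqrt (Real.log (1 / δ))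
            + Real.sqrt (d * Real.log ((k + k : ℕ) : ℝ))))}ᶜ ≤ δ := by
  set m : ℕ := k + k with hm
  have hm2 : 2 ≤ m := by omega
  have hm2' : (2 : ℝ) ≤ m := by exact_mod_cast hm2
  set s := Real.sqrt (m : ℝ) with hs
  set L := Real.sqrt (Real.log (1 / δ)) with hL
  set D := Real.sqrt (d * Real.log (m : ℝ)) with hD
  have hL0 : 0 ≤ L := Real.sqrt_nonneg _
  have hD0 : 0 ≤ D := Real.sqrt_nonneg _
  have hs0 : 0 < s := Real.sqrt_pos.2 (by linarith)
  have hss : s ^ 2 = m := Real.sq_sqrt (by linarith)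
  have hk' : (0 : ℝ) < k := by exact_mod_cast hk
  -- Absorbs the dimension terms into `D`, since `log m ≥ log 2 ≥ 1/4`.
  have hdD : Real.sqrt d ≤ 2 * D := by
    have h2 : (2 : ℝ) = Real.sqrt 4 := by
      rw [show (4 : ℝ) = 2 ^ 2 by norm_num, Real.sqrt_sq two_pos.le]
    rw [hD, h2, ← Real.sqrt_mul (by norm_num)]
    refine Real.sqrt_le_sqrt ?_
    have hl2 : (1 / 4 : ℝ) ≤ Real.log m := by
      have h := Real.log_le_log two_pos hm2'
      have := Real.log_two_gt_d9
      linarith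
    have hd0 : (0 : ℝ) ≤ d := Nat.cast_nonneg d
    nlinarith
  obtain ⟨T, hTc, hT1, hT⟩ := exists_sphere_net d (show 0 < m by omega)
  set ε : ℝ := Real.sqrt d / m with hε
  set r := R₀ / s + s * ε with hr
  -- Chosen so that `2kτ² = s²τ² = (L + 2D)²`, the exponent in the union bound.
  set τ := (L + 2 * D) / s with hτ
  have hτ0 : 0 ≤ τ := by positivity
  have hr0 : 0 ≤ r := by positivity
  have hsε : s * ε = Real.sqrt d / s := by
    rw [hε, ← hss]
    field_simp
  have hds : (d : ℝ) / s ^ 2 ≤ Real.sqrt d / s := by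
    have h1 : (d : ℝ) / s ^ 2 = Real.sqrt d / s * (Real.sqrt d / s) := by
      rw [div_mul_div_comm, Real.mul_self_sqrt (Nat.cast_nonneg d), sq]
    rw [h1]
    -- It remains to see `√d ≤ s`, which follows from `√d ≤ 2D` and `hbig`.
    refine mul_le_of_le_one_right (by positivity) ?_
    rw [div_le_one hs0]
    linarith
  have hbound : r + (d : ℝ) / s ^ 2 + τ ≤ 16 / s * (R₀ + L + D) := by
    calc r + (d : ℝ) / s ^ 2 + τ
        ≤ R₀ / s + Real.sqrt d / s + Real.sqrt d / s + (L + 2 * D) / s := by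
          rw [hr, hsε]
          linarith
      _ = (R₀ + Real.sqrt d + Real.sqrt d + (L + 2 * D)) / s := by ring
      _ ≤ 16 * (R₀ + L + D) / s := by
          refine div_le_div_of_nonneg_right ?_ hs0.le
          linarith
      _ = 16 / s * (R₀ + L + D) := by ring
  set P := Measure.pi fun _ : Fin k => stdGaussian (E d) with hP
  let bad : E d → Set (Fin k → E d) := fun y =>
    {g | (k : ℝ) * ((stdGaussian (E d)).real (badWeights y r s) + τ)
      ≤ ∑ i, (badWeights y r s).indicator (fun _ => (1 : ℝ)) (g i)}
  have hsub : {g : Fin k → E d | ∀ x : E d, ‖x‖ = 1 →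
        ∑ i, (if |inner ℝ (g i) x| ≤ R₀ / s then (1 : ℝ) else 0)
          ≤ k * (16 / s * (R₀ + L + D))}ᶜ ⊆ ⋃ y ∈ T, bad y := by
    intro g hg
    by_contra hcon
    refine hg fun x hx => ?_
    obtain ⟨y, hyT, hxy⟩ := hT x hx
    have hgy : g ∉ bad y := fun h => hcon (Set.mem_biUnion hyT h)
    have hgy' : ∑ i, (badWeights y r s).indicator (fun _ => (1 : ℝ)) (g i)
        < (k : ℝ) * ((stdGaussian (E d)).real (badWeights y r s) + τ) := not_le.1 hgy
    calc ∑ i, (if |inner ℝ (g i) x| ≤ R₀ / s then (1 : ℝ) else 0)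
        ≤ ∑ i, (badWeights y r s).indicator (fun _ => (1 : ℝ)) (g i) :=
          Finset.sum_le_sum fun i _ => indicator_abs_inner_le hxy
      _ ≤ (k : ℝ) * ((stdGaussian (E d)).real (badWeights y r s) + τ) := hgy'.le
      _ ≤ k * (16 / s * (R₀ + L + D)) := by
          refine mul_le_mul_of_nonneg_left (le_trans ?_ hbound) hk'.le
          have := stdGaussian_badWeights_le (hT1 y hyT) hr0 hs0
          linarith
  have hτm : 2 * k * τ ^ 2 = (L + 2 * D) ^ 2 := by
    have : (2 * k : ℝ) = s ^ 2 := by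
      rw [hss, hm]
      push_cast
      ring
    rw [this, hτ]
    field_simp
  calc P.real _ ≤ P.real (⋃ y ∈ T, bad y) := measureReal_mono hsub (measure_ne_top _ _)
    _ ≤ ∑ y ∈ T, P.real (bad y) := measureReal_biUnion_finset_le _ _
    _ ≤ ∑ _y ∈ T, Real.exp (-(L + 2 * D) ^ 2) := by
        refine Finset.sum_le_sum fun y _ => ?_
        rw [← hτm]
        exact pi_count_ge_le _ hk (measurableSet_badWeights y r s) hτ0
    _ = T.card * Real.exp (-(L + 2 * D) ^ 2) := by rw [Finset.sum_const, nsmul_eq_mul]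
    _ ≤ (((2 * m + 1) ^ d : ℕ) : ℝ) * Real.exp (-(L + 2 * D) ^ 2) := by
        refine mul_le_mul_of_nonneg_right ?_ (Real.exp_pos _).le
        exact_mod_cast hTc
    _ ≤ δ := net_card_mul_exp_le hm2 hδ hδ1

theorem pi_stdGaussian_count_ge {k : ℕ} (hk : 0 < k) {R₀ δ : ℝ} (hR : 0 < R₀)
    (hδ : 0 < δ) (hδ1 : δ < 1) :
    ENNReal.ofReal (1 - δ) ≤ (Measure.pi fun _ : Fin k => stdGaussian (E d))
      {g | ∀ x : E d, ‖x‖ = 1 →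
        ∑ i, (if |inner ℝ (g i) x| ≤ R₀ / Real.sqrt ((k + k : ℕ) : ℝ) then (1 : ℝ) else 0)
          ≤ k * (16 / Real.sqrt ((k + k : ℕ) : ℝ) * (R₀ + Real.sqrt (Real.log (1 / δ))
            + Real.sqrt (d * Real.log ((k + k : ℕ) : ℝ))))} := by
  set P := Measure.pi fun _ : Fin k => stdGaussian (E d)
  set G := {g : Fin k → E d | ∀ x : E d, ‖x‖ = 1 →
    ∑ i, (if |inner ℝ (g i) x| ≤ R₀ / Real.sqrt ((k + k : ℕ) : ℝ) then (1 : ℝ) else 0)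
      ≤ k * (16 / Real.sqrt ((k + k : ℕ) : ℝ) * (R₀ + Real.sqrt (Real.log (1 / δ))
        + Real.sqrt (d * Real.log ((k + k : ℕ) : ℝ))))} with hG
  have htriv : G = Set.univ → ENNReal.ofReal (1 - δ) ≤ P G := fun h => by
    rw [h, measure_univ]
    exact ENNReal.ofReal_le_one.2 (by linarith)
  -- In dimension 0 there is no unit vector, so the event is everything.
  rcases Nat.eq_zero_or_pos d with rfl | hd
  · refine htriv (Set.eq_univ_of_forall fun g x hx => ?_)
    rw [Subsingleton.elim x 0, norm_zero] at hx
    exact absurd hx zero_ne_one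
  by_cases hbig : 16 * (R₀ + Real.sqrt (Real.log (1 / δ))
      + Real.sqrt (d * Real.log ((k + k : ℕ) : ℝ))) < Real.sqrt ((k + k : ℕ) : ℝ)
  · have h := pi_stdGaussian_compl_le hk hd hR hδ hδ1 hbig
    have h' : P Gᶜ ≤ ENNReal.ofReal δ := by
      rw [← ENNReal.ofReal_toReal (measure_ne_top P Gᶜ)]
      exact ENNReal.ofReal_le_ofReal h
    rw [ENNReal.ofReal_sub _ hδ.le, ENNReal.ofReal_one, tsub_le_iff_right]
    calc (1 : ℝ≥0∞) = P Set.univ := measure_univ.symm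
      -- Subadditivity suffices, so no measurability of `G`, an intersection over all unit vectors,
      -- is needed.
      _ ≤ P G + P Gᶜ := measure_univ_le_add_compl G
      _ ≤ P G + ENNReal.ofReal δ := by gcongr
  -- Here the threshold is at least `k`, the largest possible count.
  · refine htriv (Set.eq_univ_of_forall fun g x _ => ?_)
    push Not at hbig
    have hs0 : 0 < Real.sqrt ((k + k : ℕ) : ℝ) := Real.sqrt_pos.2 (by exact_mod_cast (by omega))
    calc ∑ i, (if |inner ℝ (g i) x| ≤ R₀ / Real.sqrt ((k + k : ℕ) : ℝ) then (1 : ℝ) else 0)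
        ≤ ∑ _i : Fin k, (1 : ℝ) := Finset.sum_le_sum fun i _ => by split_ifs <;> norm_num
      _ = k * 1 := by simp
      _ ≤ _ := by
          refine mul_le_mul_of_nonneg_left ?_ (Nat.cast_nonneg k)
          rw [div_mul_eq_mul_div, le_div_iff₀ hs0, one_mul]
          exact hbig

theorem symInit_initEvent_ge {k : ℕ} (hk : 0 < k) {R₀ δ : ℝ} (hR : 0 < R₀)
    (hδ : 0 < δ) (hδ1 : δ < 1) :
    ENNReal.ofReal (1 - δ) ≤ symInit k d (initEvent k d R₀ δ) := by
  refine (pi_stdGaussian_count_ge (d := d) hk hR hδ hδ1).trans ?_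
  set G := {g : Fin k → E d | ∀ x : E d, ‖x‖ = 1 →
    ∑ i, (if |inner ℝ (g i) x| ≤ R₀ / Real.sqrt ((k + k : ℕ) : ℝ) then (1 : ℝ) else 0)
      ≤ k * (16 / Real.sqrt ((k + k : ℕ) : ℝ) * (R₀ + Real.sqrt (Real.log (1 / δ))
        + Real.sqrt (d * Real.log ((k + k : ℕ) : ℝ))))} with hG
  have hsub : (Set.univ ×ˢ G : Set (Init k d)) ⊆ initEvent k d R₀ δ := by
    rintro w ⟨-, hw⟩ x hx
    have h := hw x hx
    have hk' : (0 : ℝ) < k := by exact_mod_cast hk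
    rw [Fin.sum_univ_add]
    simp only [Init.θ, Fin.append_left, Fin.append_right]
    -- The paired neurons share their weights, so the full count is twice the count over the `k`
    -- independent rows; the signs play no role.
    rw [← two_mul (∑ i, (if |inner ℝ (w.2 i) x| ≤ _ then (1 : ℝ) else 0))]
    calc R₀ / ((k + k : ℕ) : ℝ) * (2 * ∑ i, (if |inner ℝ (w.2 i) x|
            ≤ R₀ / Real.sqrt ((k + k : ℕ) : ℝ) then (1 : ℝ) else 0))
        ≤ R₀ / ((k + k : ℕ) : ℝ) * (2 * (k * (16 / Real.sqrt ((k + k : ℕ) : ℝ)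
          * (R₀ + Real.sqrt (Real.log (1 / δ))
            + Real.sqrt (d * Real.log ((k + k : ℕ) : ℝ)))))) := by
          gcongr
      _ = rho d R₀ (k + k) δ := by
          rw [rho]
          generalize Real.sqrt ((k + k : ℕ) : ℝ) = s
          generalize Real.sqrt (d * Real.log ((k + k : ℕ) : ℝ)) = D
          push_cast
          field_simp
          ring
  calc (Measure.pi fun _ : Fin k => stdGaussian (E d)) G
      = symInit k d (Set.univ ×ˢ G) := by
        rw [symInit, Measure.prod_prod, measure_univ, one_mul]
    _ ≤ symInit k d (initEvent k d R₀ δ) := measure_mono hsub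

end UniformBound

theorem rho_nonneg (d m : ℕ) {R₀ : ℝ} (hR : 0 ≤ R₀) (δ : ℝ) : 0 ≤ rho d R₀ m δ := by
  unfold rho
  positivity

end NeuralNAC

theorem mainTheorem6 {S A : Type*} [MeasurableSpace S] [Fintype A] [Nonempty A]
    [MeasurableSpace A] [MeasurableSingletonClass A] {d k k' : ℕ} (hk : 0 < k) (hk' : 0 < k')
    (M : NeuralNAC.MDP S A d) (μ : Measure S) [IsProbabilityMeasure μ]
    (p : NeuralNAC.Params) (hR : 0 < p.R) (hlam : 0 < p.lam) (hαA : 0 < p.αA) (hαC : 0 < p.αC)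
    (hN : 0 < p.N) (hT' : 0 < p.T') (hη_pos : ∀ t, 0 < p.η t) (hη_le : ∀ t, p.η t ≤ 1 / p.lam)
    (δ : ℝ) (hδ_pos : 0 < δ) (hδ_lt : δ < 1)
    (πopt : NeuralNAC.Policy S A) (hopt : M.IsOptimal p.lam μ πopt) :
    ENNReal.ofReal (1 - δ) ≤
        NeuralNAC.symInit k d (NeuralNAC.initEvent k d (p.R / p.lam) δ) ∧
      ∀ w ∈ NeuralNAC.initEvent k d (p.R / p.lam) δ,
      ∀ (ζ : NeuralNAC.Realization S A k' d) (t : ℕ),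
        M.potential μ πopt (NeuralNAC.policyAt M p w ζ (t + 1))
            - M.potential μ πopt (NeuralNAC.policyAt M p w ζ t) ≤
          - p.η t * p.lam * M.potential μ πopt (NeuralNAC.policyAt M p w ζ t)
          - p.η t * (1 - M.γ) *
              (M.Vmean p.lam μ πopt - M.Vmean p.lam μ (NeuralNAC.policyAt M p w ζ t))
          + 2 * p.η t ^ 2 * p.R ^ 2
          + p.η t * NeuralNAC.expect (M.visit μ πopt) (NeuralNAC.policyAt M p w ζ t)
              (NeuralNAC.fitError M p w ζ t)
          - p.η t * NeuralNAC.expect (M.visit μ πopt) πopt (NeuralNAC.fitError M p w ζ t)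
          + (p.η t * p.lam + 6) * NeuralNAC.rho d (p.R / p.lam) (k + k) δ
          + 2 * p.η t * p.R * Real.sqrt (NeuralNAC.rho d (p.R / p.lam) (k + k) δ) := by
  have hr : 0 < p.R / p.lam := div_pos hR hlam
  refine ⟨NeuralNAC.symInit_initEvent_ge hk hr hδ_pos hδ_lt, fun w hw ζ t => ?_⟩
  have hρ0 := NeuralNAC.rho_nonneg d (k + k) hr.le δ
  -- The argument gives the error `4ρ₀`; the stated error exceeds it by `2ρ₀` and the nonnegative
  -- terms `h1` and `h2`.
  have h := NeuralNAC.potential_policyAt_succ_sub_le M p w ζ hk hR.le hlam hη_pos hη_le hρ0 hw μ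
    πopt t
  have h1 : 0 ≤ p.η t * p.lam * NeuralNAC.rho d (p.R / p.lam) (k + k) δ :=
    mul_nonneg (mul_pos (hη_pos t) hlam).le hρ0
  have h2 : 0 ≤ 2 * p.η t * p.R * Real.sqrt (NeuralNAC.rho d (p.R / p.lam) (k + k) δ) :=
    mul_nonneg (mul_nonneg (mul_nonneg two_pos.le (hη_pos t).le) hR.le) (Real.sqrt_nonneg _)
  linarith
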